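/- Let $M$ be a smooth $n$-manifold without boundary and let $J^1M = T^*M\times\mathbb{R}$ carry the contact form $\alpha = dz-\lambda_{can}$, whose Reeb field is $\partial_z$; let $\pi_x$, $\pi_z$ and $\pi_{xz}$ denote the projections of $J^1M$ to $M$, $\mathbb{R}$ and $M\times\mathbb{R}$. Let $\Lambda\subset J^1M$ be a closed (compact, without boundary) embedded Legendrian submanifold. A Reeb chord of $\Lambda$ is a nonconstant integral curve $\gamma$ of $\partial_z$ with both endpoints on $\Lambda$; its height is $h=\int_\gamma\alpha>0$. Write $\pi_x(\gamma)=x_0$ and $\pi_z(\gamma)=[z_-,z_+]$, so $h=z_+-z_-$. The chord $\gamma$ is frontwise doubly extendable if the front projections of its endpoints are not the front projection of any point of $\Lambda$ at which $\pi_{xz}|_\Lambda$ fails to be an immersion, and if $$\pi_{xz}^{-1}(\{x_0\}\times[z_--h,z_+])\cap\Lambda=\Lambda\cap\partial\gamma\quad\text{or}\quad \pi_{xz}^{-1}(\{x_0\}\times[z_-,z_++h])\cap\Lambda=\Lambda\cap\partial\gamma .$$ For $L\subset\mathbb{R}\times J^1M$ and $-\infty\le a<b\le\infty$ put $L_a^b=L\cap((a,b)\times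 J^1M)$, where $s$ is the coordinate on $\mathbb{R}$, and let the relative Gromov width $w(L_a^b)\in[0,\infty]$ be the supremum of $\pi r^2$ over all $r>0$ for which there is a symplectic embedding $\psi$ of the closed ball $B^{2n+2}(r)\subset(\mathbb{R}^{2n+2},\omega_0)$ into $((a,b)\times J^1M,\,d(e^s\alpha))$ with $\psi^{-1}(L_a^b)=B^{2n+2}(r)\cap\mathbb{R}^{n+1}$, where $\omega_0=\sum_i dx_i\wedge dy_i$ and $\mathbb{R}^{n+1}=\{y=0\}$. **Theorem.** If $\Lambda\subset J^1M$ has a frontwise doubly extendable Reeb chord of height $h$, then $$2h\le w\big((\mathbb{R}\times\Lambda)_{-\infty}^0\big).$$ -/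

import Mathlib

open Set
open scoped Manifold ContDiff ENNReal

noncomputable section

/-! ### Differential one-forms on manifolds and their exterior derivative -/

section Forms

variable {E H X : Type*} [NormedAddCommGroup E] [NormedSpace ℝ E] [TopologicalSpace H]
  [TopologicalSpace X] [ChartedSpace H X]

/-- The one-form `β` on a boundaryless manifold `X`, read in the preferred chart `φ` at `p`: it is
the one-form `(φ⁻¹)^* β` on (an open subset of) the model vector space. -/
def oneFormInChart (I : ModelWithCorners ℝ E H) (β : (q : X) → TangentSpace I q →L[ℝ] ℝ)
    (p : X) (y : E) : E [⋀^Fin 1]→L[ℝ] ℝ :=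
  ContinuousAlternatingMap.ofSubsingleton ℝ E ℝ (0 : Fin 1)
    ((β ((extChartAt I p).symm y)).comp (mfderiv 𝓘(ℝ, E) I (extChartAt I p).symm y))

/-- The exterior derivative `dβ` of a one-form `β` on a boundaryless manifold, at the point `p`:
`(dβ)_p = φ^* d((φ⁻¹)^* β)`, where `φ` is the preferred chart at `p`. -/
def extDerivOneForm (I : ModelWithCorners ℝ E H) [I.Boundaryless]
    (β : (q : X) → TangentSpace I q →L[ℝ] ℝ) (p : X) : TangentSpace I p [⋀^Fin 2]→L[ℝ] ℝ :=
  (extDeriv (oneFormInChart I β p) (extChartAt I p p)).compContinuousLinearMap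
    (mfderiv I 𝓘(ℝ, E) (extChartAt I p) p)

end Forms

/-! ### The one-jet space, its contact form and its symplectization -/

section JetSpace

variable (n : ℕ) (M : Type*) [TopologicalSpace M] [ChartedSpace (EuclideanSpace ℝ (Fin n)) M]

/-- The cotangent bundle `T^*M` of an `n`-manifold `M`. -/
abbrev CotangentBundle : Type _ :=
  Bundle.TotalSpace (EuclideanSpace ℝ (Fin n) →L[ℝ] ℝ)
    (fun x : M => TangentSpace (𝓡 n) x →L[ℝ] Bundle.Trivial M ℝ x)

/-- The one-jet space `J^1 M = T^*M × ℝ`; the second factor is the `z`-coordinate. -/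
abbrev JetSpace : Type _ := CotangentBundle n M × ℝ

/-- The underlying manifold `ℝ × J^1 M` of the symplectization; the first factor is the
`s`-coordinate. -/
abbrev Symplectization : Type _ := ℝ × JetSpace n M

/-- The model of `T^*M` as a smooth manifold. -/
abbrev cotangentModel :=
  (𝓡 n).prod 𝓘(ℝ, EuclideanSpace ℝ (Fin n) →L[ℝ] ℝ)

/-- The model of `J^1 M` as a smooth manifold. -/
abbrev jetModel := (cotangentModel n).prod 𝓘(ℝ, ℝ)

/-- The model of `ℝ × J^1 M` as a smooth manifold. -/
abbrev symplModel := 𝓘(ℝ, ℝ).prod (jetModel n)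

variable {n M}
variable [IsManifold (𝓡 n) ∞ M]

/-- The canonical one-form on `T^*M`: `λ_{(x,y)}(v) = y (dπ v)` with `π : T^*M → M`. -/
def canonicalForm (q : CotangentBundle n M) : TangentSpace (cotangentModel n) q →L[ℝ] ℝ :=
  ContinuousLinearMap.comp (q.2 : TangentSpace (𝓡 n) q.1 →L[ℝ] ℝ)
    (mfderiv (cotangentModel n) (𝓡 n)
      (Bundle.TotalSpace.proj : CotangentBundle n M → M) q)

/-- The one-form `dz` on `J^1 M`. -/
def dzForm (p : JetSpace n M) : TangentSpace (jetModel n) p →L[ℝ] ℝ :=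
  mfderiv (jetModel n) 𝓘(ℝ, ℝ) (Prod.snd : JetSpace n M → ℝ) p

/-- The contact form `α = dz - λ` on `J^1 M`. -/
def contactForm (p : JetSpace n M) : TangentSpace (jetModel n) p →L[ℝ] ℝ :=
  dzForm p - (canonicalForm p.1).comp
    (mfderiv (jetModel n) (cotangentModel n) (Prod.fst : JetSpace n M → CotangentBundle n M) p)

/-- The one-form `e^s α` on `ℝ × J^1 M`. -/
def liouvilleForm (u : Symplectization n M) : TangentSpace (symplModel n) u →L[ℝ] ℝ :=
  Real.exp u.1 • (contactForm u.2).comp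
    (mfderiv (symplModel n) (jetModel n) (Prod.snd : Symplectization n M → JetSpace n M) u)

/-- The symplectic form `d(e^s α)` on `ℝ × J^1 M`. -/
def symplForm (u : Symplectization n M) : TangentSpace (symplModel n) u [⋀^Fin 2]→L[ℝ] ℝ :=
  extDerivOneForm (symplModel n) liouvilleForm u

/-- The Reeb vector field `∂_z` of the contact form `α` on `J^1 M`. -/
def reebField (p : JetSpace n M) : TangentSpace (jetModel n) p :=
  ((0 : TangentSpace (cotangentModel n) p.1), (1 : ℝ))

/-- The front projection `π_{xz} : J^1 M → M × ℝ`. -/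
def front (p : JetSpace n M) : M × ℝ := (p.1.proj, p.2)

/-! ### Legendrians and Reeb chords -/

variable {N : Type*} [TopologicalSpace N] [ChartedSpace (EuclideanSpace ℝ (Fin n)) N]

/-- `ι : N → J^1 M` is a Legendrian embedding of the `n`-manifold `N`: a smooth embedding whose
tangent spaces lie in `ker α`. -/
structure IsLegendrianEmbedding (ι : N → JetSpace n M) : Prop where
  isSmoothEmbedding : Manifold.IsSmoothEmbedding (𝓡 n) (jetModel n) ∞ ι
  tangent : ∀ (x : N) (v : TangentSpace (𝓡 n) x),
    contactForm (ι x) (mfderiv (𝓡 n) (jetModel n) ι x v) = 0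

/-- `γ`, restricted to `[0,h]`, is a Reeb chord of `Λ` of height `h`: an integral curve of the Reeb
field with both endpoints on `Λ`. As `α` equals `1` on the Reeb field, `h` is the integral of `α`
along `γ`. -/
structure IsReebChord (Λ : Set (JetSpace n M)) (γ : ℝ → JetSpace n M) (h : ℝ) : Prop where
  height_pos : 0 < h
  isIntegralCurve : IsMIntegralCurveOn (I := jetModel n) γ reebField (Icc 0 h)
  start_mem : γ 0 ∈ Λ
  end_mem : γ h ∈ Λ

/-- `x : N` is a singular point of the front projection of the Legendrian `ι`: the front projection
`π_{xz} ∘ ι` is not an immersion at `x`. -/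
def IsFrontSingular (ι : N → JetSpace n M) (x : N) : Prop :=
  ¬ Function.Injective
    (mfderiv (𝓡 n) ((𝓡 n).prod 𝓘(ℝ, ℝ)) (fun x => front (ι x)) x)

/-- The Reeb chord `γ` of height `h` of the Legendrian `Λ = ι(N)` is frontwise doubly extendable:
its endpoints do not project to singularities of the front and, if the chord lies over `x₀ : M` and
`[z₋, z₊]` is the set of its heights, then the points of `Λ` over `{x₀} × [z₋ - h, z₊]`, or those
over `{x₀} × [z₋, z₊ + h]`, are just the endpoints of `γ`. -/
def IsFrontwiseDoublyExtendable (ι : N → JetSpace n M) (γ : ℝ → JetSpace n M) (h : ℝ) : Prop :=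
  (∀ x : N, IsFrontSingular ι x → front (ι x) ≠ front (γ 0) ∧ front (ι x) ≠ front (γ h)) ∧
  (front ⁻¹' ({(γ 0).1.proj} ×ˢ Icc ((γ 0).2 - h) (γ h).2) ∩ range ι = range ι ∩ {γ 0, γ h} ∨
    front ⁻¹' ({(γ 0).1.proj} ×ˢ Icc (γ 0).2 ((γ h).2 + h)) ∩ range ι = range ι ∩ {γ 0, γ h})

/-! ### Relative symplectic embeddings of balls and the relative Gromov width -/

/-- The standard vector space `ℝ^{2m}`, with coordinates `x_i = v (inl i)`, `y_i = v (inr i)`. -/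
abbrev StdSpace (m : ℕ) : Type := EuclideanSpace ℝ (Fin m ⊕ Fin m)

/-- The standard symplectic form `ω₀ = ∑ dx_i ∧ dy_i` on `ℝ^{2m}`. -/
def stdForm {m : ℕ} (v w : StdSpace m) : ℝ :=
  ∑ i : Fin m, (v (Sum.inl i) * w (Sum.inr i) - v (Sum.inr i) * w (Sum.inl i))

/-- The part `L_a^b` of `L ⊆ ℝ × J^1 M` where `a < s < b`. -/
def slab (L : Set (Symplectization n M)) (a b : EReal) : Set (Symplectization n M) :=
  {u ∈ L | a < (u.1 : EReal) ∧ (u.1 : EReal) < b}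

/-- `ψ` restricts to a symplectic embedding of the closed ball `B^{2n+2}(r)` into
`((a,b) × J^1 M, d(e^s α))` relative to `L_a^b`: it is smooth on a neighbourhood of the ball,
injective on the ball, pulls back `d(e^s α)` to `ω₀`, and maps exactly the points of
`B^{2n+2}(r) ∩ ℝ^{n+1}` to `L_a^b`. -/
structure IsRelSymplEmbedding (L : Set (Symplectization n M)) (a b : EReal) (r : ℝ)
    (ψ : StdSpace (n + 1) → Symplectization n M) : Prop where
  smooth : ∃ U : Set (StdSpace (n + 1)), IsOpen U ∧ Metric.closedBall 0 r ⊆ U ∧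
    ContMDiffOn 𝓘(ℝ, StdSpace (n + 1)) (symplModel n) ∞ ψ U
  injOn : InjOn ψ (Metric.closedBall 0 r)
  mapsTo : MapsTo ψ (Metric.closedBall 0 r) (slab univ a b)
  symplectic : ∀ p ∈ Metric.closedBall (0 : StdSpace (n + 1)) r, ∀ v w : StdSpace (n + 1),
    symplForm (ψ p) ![mfderiv 𝓘(ℝ, StdSpace (n + 1)) (symplModel n) ψ p v,
      mfderiv 𝓘(ℝ, StdSpace (n + 1)) (symplModel n) ψ p w] = stdForm v w
  relative : ∀ p ∈ Metric.closedBall (0 : StdSpace (n + 1)) r,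
    ψ p ∈ slab L a b ↔ ∀ i : Fin (n + 1), p (Sum.inr i) = 0

/-- The relative Gromov width `w(L_a^b)`: the supremum of `π r²` over all `r > 0` for which the
closed ball of radius `r` embeds symplectically into `(a,b) × J^1 M` relative to `L_a^b`. -/
def relGromovWidth (L : Set (Symplectization n M)) (a b : EReal) : ℝ≥0∞ :=
  sSup {c | ∃ r : ℝ, 0 < r ∧ (∃ ψ, IsRelSymplEmbedding L a b r ψ) ∧
    c = ENNReal.ofReal (Real.pi * r ^ 2)}

end JetSpace

end

/-! Put `u = e^s`, so that `s < 0` means `u ∈ (0,1)`. In the `(s,z)`-plane `d(e^s dz) = du ∧ dz`. At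
one endpoint of the chord, extendability leaves the vertical line free of further points of `Λ` at
distance less than `h`, above and below. Measured relative to `Λ`, the available rectangle `(0,1) ×
(-h,h)` has area `2h` and is symmetric about the zero line. A disc of area below `2h` maps into it
by an area-preserving map `(x,y) ↦ (u x, y / v x)` with `u' = v`, carrying its horizontal diameter
to the zero line (`isDiscProfile`).

The other `n` coordinate pairs cost nothing, because cotangent fibres are unbounded: the base
directions are squeezed by a small `δ` and the fibres stretched by `1/(δu)`. Near the chosen
endpoint the front is regular, so `Λ` is the one-jet of a function `f`
(`IsLegendrianEmbedding.exists_local_primitive`), and shearing by this one-jet places the zero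
section on `Λ`. The resulting `squeezeMap` pulls `e^s(dz - y dx)` back to an exact form plus `-∑ y_i
dx_i` (`modelLiouvilleForm_squeezeMap`), hence is symplectic by naturality of `d`
(`extDerivOneForm_mfderiv`).

The embedding is relative to the cylinder if no other sheet of `Λ` meets the image. This is known
only over the endpoint itself; compactness extends it to nearby vertical lines, with a slight loss
of height (`eventually_forall_mem_of_front_segment`), and `δ` confines the image to these. -/

noncomputable section

open Bundle Filter Topology

/-! ### Bundle charts as Darboux charts: the contact and Liouville forms in coordinates. -/

section Charts

variable {n : ℕ} {M : Type*} [TopologicalSpace M] [ChartedSpace (EuclideanSpace ℝ (Fin n)) M]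

/-- The model vector space of `T^*M`. -/
abbrev CotangentModelSpace (n : ℕ) : Type :=
  EuclideanSpace ℝ (Fin n) × (EuclideanSpace ℝ (Fin n) →L[ℝ] ℝ)

/-- The model vector space of `J^1 M`. -/
abbrev JetModelSpace (n : ℕ) : Type := CotangentModelSpace n × ℝ

/-- The projection of the model of `J^1 M` to the model of `M`. -/
def jetModelBase (n : ℕ) : JetModelSpace n →L[ℝ] EuclideanSpace ℝ (Fin n) :=
  (ContinuousLinearMap.fst ℝ _ _).comp (ContinuousLinearMap.fst ℝ _ _)

@[simp] lemma jetModelBase_apply (y : JetModelSpace n) : jetModelBase n y = y.1.1 := rfl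

/-- The one-form `dz - y dx` on the model vector space of `J^1 M`. -/
def modelContactForm (y : JetModelSpace n) : JetModelSpace n →L[ℝ] ℝ :=
  ContinuousLinearMap.snd ℝ _ _ - y.1.2.comp (jetModelBase n)

@[simp] lemma modelContactForm_apply (y v : JetModelSpace n) :
    modelContactForm y v = v.2 - y.1.2 v.1.1 := rfl

/-- The one-form `e^s (dz - y dx)` on the model vector space of `ℝ × J^1 M`. -/
def modelLiouvilleForm (y : ℝ × JetModelSpace n) : ℝ × JetModelSpace n →L[ℝ] ℝ :=
  Real.exp y.1 • (modelContactForm y.2).comp (ContinuousLinearMap.snd ℝ _ _)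

@[simp] lemma modelLiouvilleForm_apply (y v : ℝ × JetModelSpace n) :
    modelLiouvilleForm y v = Real.exp y.1 * (v.2.2 - y.2.1.2 v.2.1.1) := rfl

lemma contDiff_modelLiouvilleForm : ContDiff ℝ ∞ (modelLiouvilleForm (n := n)) := by
  refine contDiff_clm_apply_iff.2 fun v => ?_
  simp only [modelLiouvilleForm_apply]
  have h : ContDiff ℝ ∞ fun y : ℝ × JetModelSpace n => y.2.1.2 := by fun_prop
  exact (Real.contDiff_exp.comp contDiff_fst).mul
    (contDiff_const.sub (h.clm_apply contDiff_const))

variable [IsManifold (𝓡 n) ∞ M]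

lemma cotangent_extChartAt_target (q₀ : CotangentBundle n M) :
    (extChartAt (cotangentModel n) q₀).target = (extChartAt (𝓡 n) q₀.proj).target ×ˢ univ := by
  rw [FiberBundle.extChartAt_target]
  congr 1
  ext x
  simp only [mem_inter_iff, and_iff_left_iff_imp]
  intro hx
  have := (extChartAt (𝓡 n) q₀.proj).map_target hx
  rw [extChartAt_source] at this
  simpa [hom_trivializationAt_baseSet] using this

lemma cotangent_extChartAt_symm_proj (q₀ : CotangentBundle n M) {y : CotangentModelSpace n}
    (hy : y ∈ (extChartAt (cotangentModel n) q₀).target) :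
    ((extChartAt (cotangentModel n) q₀).symm y).proj
      = (extChartAt (𝓡 n) q₀.proj).symm y.1 := by
  rw [FiberBundle.extChartAt_target] at hy
  rw [FiberBundle.extChartAt]
  have : ((extChartAt (𝓡 n) q₀.proj).symm y.1, y.2) ∈
      (trivializationAt (EuclideanSpace ℝ (Fin n) →L[ℝ] ℝ)
        (fun x : M => TangentSpace (𝓡 n) x →L[ℝ] Bundle.Trivial M ℝ x) q₀.proj).target := by
    rw [Trivialization.mem_target]
    exact hy.1.2
  exact Trivialization.proj_symm_apply _ this

/-- The trivialization of the cotangent bundle is dual to that of the tangent bundle, whose inverse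
on fibres is the derivative of the inverse chart. This is why the canonical form becomes `y dx` in a
bundle chart. -/
lemma cotangent_extChartAt_symm_snd (q₀ : CotangentBundle n M) {y : CotangentModelSpace n}
    (hy : y ∈ (extChartAt (cotangentModel n) q₀).target) (v : EuclideanSpace ℝ (Fin n)) :
    (((extChartAt (cotangentModel n) q₀).symm y).2 : EuclideanSpace ℝ (Fin n) →L[ℝ] ℝ)
      (mfderiv 𝓘(ℝ, EuclideanSpace ℝ (Fin n)) (𝓡 n) (extChartAt (𝓡 n) q₀.proj).symm y.1 v)
      = y.2 v := by
  have h1 := (extChartAt (cotangentModel n) q₀).right_inv hy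
  have hp := cotangent_extChartAt_symm_proj q₀ hy
  set q := (extChartAt (cotangentModel n) q₀).symm y with hq
  rw [cotangent_extChartAt_target] at hy
  have hy1 := hy.1
  have hs : q.proj ∈ (chartAt (EuclideanSpace ℝ (Fin n)) q₀.proj).source := by
    rw [hp, ← extChartAt_source (𝓡 n)]
    exact (extChartAt (𝓡 n) q₀.proj).map_target hy1
  rw [FiberBundle.extChartAt] at h1
  have h2 : (trivializationAt (EuclideanSpace ℝ (Fin n) →L[ℝ] ℝ)
    (fun x : M => TangentSpace (𝓡 n) x →L[ℝ] Bundle.Trivial M ℝ x) q₀.proj q).2 = y.2 :=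
    congrArg Prod.snd h1
  rw [hom_trivializationAt_apply] at h2
  rw [← h2]
  simp only [ContinuousLinearMap.inCoordinates]
  rw [TangentBundle.symmL_trivializationAt hs, hp, (extChartAt (𝓡 n) q₀.proj).right_inv hy1]
  simp [mfderivWithin_univ]
  rfl

lemma jet_extChartAt_target (p₀ : JetSpace n M) :
    (extChartAt (jetModel n) p₀).target =
      ((extChartAt (𝓡 n) p₀.1.proj).target ×ˢ univ) ×ˢ univ := by
  rw [extChartAt_prod, PartialEquiv.prod_target, cotangent_extChartAt_target,
    extChartAt_model_space_eq_id]
  rfl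

lemma sympl_extChartAt_target (u₀ : Symplectization n M) :
    (extChartAt (symplModel n) u₀).target =
      univ ×ˢ ((extChartAt (𝓡 n) u₀.2.1.proj).target ×ˢ univ) ×ˢ univ := by
  rw [extChartAt_prod, PartialEquiv.prod_target, jet_extChartAt_target, extChartAt_model_space_eq_id]
  rfl

lemma front_extChartAt_symm (p₀ : JetSpace n M) {y : JetModelSpace n}
    (hy : y ∈ (extChartAt (jetModel n) p₀).target) :
    front ((extChartAt (jetModel n) p₀).symm y) =
      ((extChartAt (𝓡 n) p₀.1.proj).symm y.1.1, y.2) := by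
  rw [extChartAt_prod] at hy ⊢
  rw [PartialEquiv.prod_target] at hy
  ext
  · exact cotangent_extChartAt_symm_proj p₀.1 hy.1
  · rfl

lemma contMDiffAt_extChartAt_symm_of_mem_target {E H X : Type*} [NormedAddCommGroup E]
    [NormedSpace ℝ E] [TopologicalSpace H] [TopologicalSpace X] [ChartedSpace H X]
    (I : ModelWithCorners ℝ E H) [I.Boundaryless] [IsManifold I ∞ X] (p : X) {y : E}
    (hy : y ∈ (extChartAt I p).target) :
    ContMDiffAt 𝓘(ℝ, E) I ∞ (extChartAt I p).symm y :=
  (contMDiffOn_extChartAt_symm p).contMDiffAt ((isOpen_extChartAt_target p).mem_nhds hy)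

lemma mfderiv_apply_mfderiv_of_eventuallyEq {E H X E' H' X' F : Type*} [NormedAddCommGroup E]
    [NormedSpace ℝ E] [TopologicalSpace H] [TopologicalSpace X] [ChartedSpace H X]
    {I : ModelWithCorners ℝ E H} [NormedAddCommGroup E']
    [NormedSpace ℝ E'] [TopologicalSpace H'] [TopologicalSpace X'] [ChartedSpace H' X']
    {I' : ModelWithCorners ℝ E' H'} [NormedAddCommGroup F] [NormedSpace ℝ F]
    {f : X → X'} {g : F → X} {k : F → X'} {y : F} (hfg : f ∘ g =ᶠ[𝓝 y] k)
    (hf : MDifferentiableAt I I' f (g y)) (hg : MDifferentiableAt 𝓘(ℝ, F) I g y)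
    (v : F) :
    mfderiv I I' f (g y) (mfderiv 𝓘(ℝ, F) I g y v) = mfderiv 𝓘(ℝ, F) I' k y v := by
  rw [← hfg.mfderiv_eq]
  exact (mfderiv_comp_apply y hf hg v).symm

/-- The covector component of a point of `J^1 M`, in the model fibre of `T^*M`. -/
def jetCovector (p : JetSpace n M) : EuclideanSpace ℝ (Fin n) →L[ℝ] ℝ := p.1.2

lemma contactForm_apply (p : JetSpace n M) (w : TangentSpace (jetModel n) p) :
    contactForm p w = dzForm p w - jetCovector p
        (mfderiv (jetModel n) (𝓡 n) (fun p : JetSpace n M => p.1.proj) p w) := by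
  have : mfderiv (jetModel n) (𝓡 n) (fun p : JetSpace n M => p.1.proj) p w =
      mfderiv (cotangentModel n) (𝓡 n) (TotalSpace.proj : CotangentBundle n M → M) p.1
      (mfderiv (jetModel n) (cotangentModel n) (Prod.fst : JetSpace n M → CotangentBundle n M)
      p w) := by
    exact mfderiv_comp_apply (I' := cotangentModel n)
      (g := (TotalSpace.proj : CotangentBundle n M → M)) p
      ((contMDiff_proj _).mdifferentiableAt (n := ∞) (by simp)) mdifferentiableAt_fst w
  rw [this]
  rfl

/-- Both ingredients of `α` factor through the front: its chart expression gives `dz` and the base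
vector, and duality of the trivializations evaluates the covector on the latter. -/
lemma contactForm_mfderiv_extChartAt_symm (p₀ : JetSpace n M) {y : JetModelSpace n}
    (hy : y ∈ (extChartAt (jetModel n) p₀).target) (v : JetModelSpace n) :
    contactForm ((extChartAt (jetModel n) p₀).symm y)
      (mfderiv 𝓘(ℝ, JetModelSpace n) (jetModel n) (extChartAt (jetModel n) p₀).symm y v)
      = modelContactForm y v := by
  have hΦ : MDifferentiableAt 𝓘(ℝ, JetModelSpace n) (jetModel n)
      (extChartAt (jetModel n) p₀).symm y :=
    (contMDiffAt_extChartAt_symm_of_mem_target _ p₀ hy).mdifferentiableAt (by simp)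
  have hnhds := (isOpen_extChartAt_target (I := jetModel n) p₀).mem_nhds hy
  have hz : mfderiv (jetModel n) 𝓘(ℝ, ℝ) (Prod.snd : JetSpace n M → ℝ)
      ((extChartAt (jetModel n) p₀).symm y)
      (mfderiv 𝓘(ℝ, JetModelSpace n) (jetModel n) (extChartAt (jetModel n) p₀).symm y v) =
      v.2 := by
    refine (mfderiv_apply_mfderiv_of_eventuallyEq (k := (Prod.snd : JetModelSpace n → ℝ)) ?_
      mdifferentiableAt_snd hΦ v).trans ?_
    · filter_upwards [hnhds] with w hw
      exact congrArg Prod.snd (front_extChartAt_symm p₀ hw)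
    · rw [mfderiv_eq_fderiv, fderiv_snd]
      rfl
  have hy' := hy
  rw [extChartAt_prod, PartialEquiv.prod_target] at hy'
  have hχ : y.1.1 ∈ (extChartAt (𝓡 n) p₀.1.proj).target := by
    rw [jet_extChartAt_target] at hy
    exact hy.1.1
  have hx : mfderiv (jetModel n) (𝓡 n) (fun p : JetSpace n M => p.1.proj)
      ((extChartAt (jetModel n) p₀).symm y)
      (mfderiv 𝓘(ℝ, JetModelSpace n) (jetModel n) (extChartAt (jetModel n) p₀).symm y v) =
      mfderiv 𝓘(ℝ, EuclideanSpace ℝ (Fin n)) (𝓡 n) (extChartAt (𝓡 n) p₀.1.proj).symm y.1.1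
        v.1.1 := by
    refine (mfderiv_apply_mfderiv_of_eventuallyEq
      (k := (extChartAt (𝓡 n) p₀.1.proj).symm ∘ jetModelBase n) ?_ ?_ hΦ v).trans ?_
    · filter_upwards [hnhds] with w hw
      exact congrArg Prod.fst (front_extChartAt_symm p₀ hw)
    · exact (((contMDiff_proj _).comp contMDiff_fst).mdifferentiableAt (n := ∞) (by simp))
    · refine (mfderiv_comp_apply (I' := 𝓘(ℝ, EuclideanSpace ℝ (Fin n))) y ?_ ?_ v).trans ?_
      · exact (contMDiffAt_extChartAt_symm_of_mem_target _ _ hχ).mdifferentiableAt (by simp)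
      · exact (jetModelBase n).differentiable.differentiableAt.mdifferentiableAt
      · rw [mfderiv_eq_fderiv, (jetModelBase n).fderiv]
        rfl
  rw [contactForm_apply]
  refine congrArg₂ _ hz ?_
  refine (congrArg _ hx).trans ?_
  have hc : jetCovector ((extChartAt (jetModel n) p₀).symm y) =
      (((extChartAt (cotangentModel n) p₀.1).symm y.1).2 : EuclideanSpace ℝ (Fin n) →L[ℝ] ℝ) := by
    rw [extChartAt_prod]
    rfl
  exact (DFunLike.congr_fun hc _).trans (cotangent_extChartAt_symm_snd p₀.1 hy'.1 v.1.1)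

lemma liouvilleForm_mfderiv_extChartAt_symm (u₀ : Symplectization n M) {y : ℝ × JetModelSpace n}
    (hy : y ∈ (extChartAt (symplModel n) u₀).target) (v : ℝ × JetModelSpace n) :
    liouvilleForm ((extChartAt (symplModel n) u₀).symm y)
      (mfderiv 𝓘(ℝ, ℝ × JetModelSpace n) (symplModel n) (extChartAt (symplModel n) u₀).symm y v)
      = modelLiouvilleForm y v := by
  have hΦ : MDifferentiableAt 𝓘(ℝ, ℝ × JetModelSpace n) (symplModel n)
      (extChartAt (symplModel n) u₀).symm y :=
    (contMDiffAt_extChartAt_symm_of_mem_target _ u₀ hy).mdifferentiableAt (by simp)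
  have hy' : y.2 ∈ (extChartAt (jetModel n) u₀.2).target := by
    rw [extChartAt_prod, PartialEquiv.prod_target] at hy
    exact hy.2
  have key : mfderiv (symplModel n) (jetModel n) (Prod.snd : Symplectization n M → JetSpace n M)
      ((extChartAt (symplModel n) u₀).symm y)
      (mfderiv 𝓘(ℝ, ℝ × JetModelSpace n) (symplModel n) (extChartAt (symplModel n) u₀).symm y v) =
      mfderiv 𝓘(ℝ, JetModelSpace n) (jetModel n) (extChartAt (jetModel n) u₀.2).symm y.2 v.2 := by
    refine (mfderiv_apply_mfderiv_of_eventuallyEq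
      (k := (extChartAt (jetModel n) u₀.2).symm ∘ (ContinuousLinearMap.snd ℝ ℝ (JetModelSpace n)))
      ?_ mdifferentiableAt_snd hΦ v).trans ?_
    · exact Eventually.of_forall fun w => by rw [extChartAt_prod]; rfl
    · refine (mfderiv_comp_apply (I' := 𝓘(ℝ, JetModelSpace n)) y ?_ ?_ v).trans ?_
      · exact (contMDiffAt_extChartAt_symm_of_mem_target _ _ hy').mdifferentiableAt (by simp)
      · exact (ContinuousLinearMap.snd ℝ ℝ (JetModelSpace n)).differentiable.differentiableAt.mdifferentiableAt
      · rw [mfderiv_eq_fderiv, (ContinuousLinearMap.snd ℝ ℝ (JetModelSpace n)).fderiv]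
        rfl
  have hc := contactForm_mfderiv_extChartAt_symm u₀.2 hy' v.2
  have h2 : ((extChartAt (symplModel n) u₀).symm y) = (y.1, (extChartAt (jetModel n) u₀.2).symm y.2) := by
    rw [extChartAt_prod]
    rfl
  have h3 : contactForm ((extChartAt (symplModel n) u₀).symm y).2 
     (mfderiv (symplModel n) (jetModel n) (Prod.snd : Symplectization n M → JetSpace n M)
      ((extChartAt (symplModel n) u₀).symm y)
      (mfderiv 𝓘(ℝ, ℝ × JetModelSpace n) (symplModel n) (extChartAt (symplModel n) u₀).symm y v)) = modelContactForm y.2 v.2 := by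
    rw [← hc]
    refine (congrArg _ key).trans ?_
    rw [h2]
  have h4 : Real.exp ((extChartAt (symplModel n) u₀).symm y).1 = Real.exp y.1 := by rw [h2]
  exact congrArg₂ (· * ·) h4 h3

end Charts

/-! ### Exterior derivative of one-forms on a vector space. -/

section OneForms

lemma minSmoothness_two_le_infty : minSmoothness ℝ 2 ≤ ((⊤ : ℕ∞) : WithTop ℕ∞) := by
  rw [minSmoothness_of_isRCLikeNormedField]
  exact WithTop.coe_le_coe.2 (le_top : (2 : ℕ∞) ≤ ⊤)

variable {F : Type*} [NormedAddCommGroup F] [NormedSpace ℝ F]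

lemma differentiableAt_ofSubsingleton {θ : F → F →L[ℝ] ℝ} {p : F} (hθ : DifferentiableAt ℝ θ p) :
    DifferentiableAt ℝ (fun q => ContinuousAlternatingMap.ofSubsingleton ℝ F ℝ (0 : Fin 1) (θ q)) p :=
  (ContinuousAlternatingMap.ofSubsingletonLIE (𝕜 := ℝ) (E := F) (F := ℝ)
    (0 : Fin 1)).toContinuousLinearEquiv.differentiableAt.comp p hθ

lemma extDeriv_ofSubsingleton_apply {θ : F → F →L[ℝ] ℝ} {p : F} (hθ : DifferentiableAt ℝ θ p)
    (v w : F) :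
    extDeriv (fun q => ContinuousAlternatingMap.ofSubsingleton ℝ F ℝ (0 : Fin 1) (θ q)) p ![v, w] =
      fderiv ℝ θ p v w - fderiv ℝ θ p w v := by
  have h : ∀ e e' : F, fderiv ℝ (fun q => θ q e) p e' = fderiv ℝ θ p e' e := fun e e' => by
    rw [fderiv_clm_apply hθ (differentiableAt_const e)]
    simp
  rw [extDeriv_apply (differentiableAt_ofSubsingleton hθ), Fin.sum_univ_two]
  simp [Fin.removeNth, h, sub_eq_add_neg]

end OneForms

/-! ### Naturality of the exterior derivative on a manifold. -/

section Pullback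

variable {E H X F : Type*} [NormedAddCommGroup E] [NormedSpace ℝ E] [TopologicalSpace H]
  [TopologicalSpace X] [ChartedSpace H X] [NormedAddCommGroup F] [NormedSpace ℝ F]

/-- Naturality of the exterior derivative of a one-form under a smooth map from a vector space. -/
lemma extDerivOneForm_mfderiv (I : ModelWithCorners ℝ E H) [I.Boundaryless] [IsManifold I ∞ X]
    (β : (q : X) → TangentSpace I q →L[ℝ] ℝ) {ψ : F → X} {U : Set F} (hU : IsOpen U)
    (hψ : ContMDiffOn 𝓘(ℝ, F) I ∞ ψ U) {p : F} (hp : p ∈ U)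
    (hβ : DifferentiableAt ℝ (oneFormInChart I β (ψ p)) (extChartAt I (ψ p) (ψ p)))
    {θ : F → F →L[ℝ] ℝ} (hθ : ∀ q ∈ U, ∀ v : F, β (ψ q) (mfderiv 𝓘(ℝ, F) I ψ q v) = θ q v)
    (v w : F) :
    extDerivOneForm I β (ψ p) ![mfderiv 𝓘(ℝ, F) I ψ p v, mfderiv 𝓘(ℝ, F) I ψ p w] =
      extDeriv (fun q => ContinuousAlternatingMap.ofSubsingleton ℝ F ℝ (0 : Fin 1) (θ q)) p
        ![v, w] := by
  have hat : ∀ q ∈ U, ContMDiffAt 𝓘(ℝ, F) I ∞ ψ q := fun q hq => hψ.contMDiffAt (hU.mem_nhds hq)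
  set φ := extChartAt I (ψ p) with hφ
  set c : F → E := φ ∘ ψ with hc
  have hsrc : ∀ᶠ q in 𝓝 p, ψ q ∈ φ.source :=
    (hat p hp).continuousAt (extChartAt_source_mem_nhds (I := I) (ψ p))
  have hinv : ∀ᶠ q in 𝓝 p, φ.symm ∘ c =ᶠ[𝓝 q] ψ := by
    filter_upwards [hsrc.eventually_nhds] with q hq
    filter_upwards [hq] with q' hq'
    exact φ.left_inv hq'
  have hcat : ∀ q ∈ U, ψ q ∈ φ.source → ContMDiffAt 𝓘(ℝ, F) 𝓘(ℝ, E) ∞ c q := fun q hq hq' =>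
    (contMDiffAt_extChartAt' (by rwa [hφ, extChartAt_source] at hq')).comp q (hat q hq)
  -- Near `p` one has `ψ = φ⁻¹ ∘ c`, so `θ` is the pullback by `c` of the chart reading of `β`;
  -- naturality between vector spaces then applies.
  have hpull : (fun q => ContinuousAlternatingMap.ofSubsingleton ℝ F ℝ (0 : Fin 1) (θ q)) =ᶠ[𝓝 p]
      fun q => (oneFormInChart I β (ψ p) (c q)).compContinuousLinearMap (fderiv ℝ c q) := by
    filter_upwards [hsrc, hinv, hU.mem_nhds hp] with q hq hq' hqU
    ext u
    have h1 : mfderiv 𝓘(ℝ, E) I φ.symm (c q) (mfderiv 𝓘(ℝ, F) 𝓘(ℝ, E) c q (u 0)) =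
        mfderiv 𝓘(ℝ, F) I ψ q (u 0) := by
      refine mfderiv_apply_mfderiv_of_eventuallyEq hq' ?_ ?_ _
      · exact (contMDiffAt_extChartAt_symm_of_mem_target I (ψ p)
          (φ.map_source hq)).mdifferentiableAt (by simp)
      · exact (hcat q hqU hq).mdifferentiableAt (by simp)
    have h2 : φ.symm (c q) = ψ q := φ.left_inv hq
    -- The type of `β x` depends on `x`, but every tangent space unfolds to `E`, so points and
    -- vectors can be replaced together.
    have h3 : ∀ (x x' : X) (e e' : E), x = x' → e = e' →
        (show E →L[ℝ] ℝ from β x) e = (show E →L[ℝ] ℝ from β x') e' := by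
      rintro x _ e _ rfl rfl
      rfl
    refine (hθ q hqU (u 0)).symm.trans ((h3 _ _ _ _ h2 h1).symm.trans ?_)
    rw [mfderiv_eq_fderiv]
    rfl
  rw [hpull.extDeriv_eq, extDeriv_pullback (f := c) (r := ∞) hβ
    (contMDiffAt_iff_contDiffAt.1 (hcat p hp hsrc.self_of_nhds)) minSmoothness_two_le_infty]
  have h4 : ∀ e : F, mfderiv I 𝓘(ℝ, E) φ (ψ p) (mfderiv 𝓘(ℝ, F) I ψ p e) = fderiv ℝ c p e := by
    intro e
    rw [← mfderiv_eq_fderiv]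
    exact mfderiv_apply_mfderiv_of_eventuallyEq (EventuallyEq.refl _ _)
      ((contMDiffAt_extChartAt (n := ∞)).mdifferentiableAt (by simp))
      ((hat p hp).mdifferentiableAt (by simp)) e
  refine congrArg (extDeriv (oneFormInChart I β (ψ p)) (c p)) ?_
  funext i
  fin_cases i
  · exact h4 v
  · exact h4 w

end Pullback

/-! ### A criterion for maps into a chart of the symplectization to be symplectic. -/

section Symplectic

variable {n : ℕ} {M : Type*} [TopologicalSpace M] [ChartedSpace (EuclideanSpace ℝ (Fin n)) M]
  [IsManifold (𝓡 n) ∞ M]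

lemma differentiableAt_oneFormInChart_liouvilleForm (u : Symplectization n M) :
    DifferentiableAt ℝ (oneFormInChart (symplModel n) liouvilleForm u)
      (extChartAt (symplModel n) u u) := by
  have h : (oneFormInChart (symplModel n) liouvilleForm u) =ᶠ[𝓝 (extChartAt (symplModel n) u u)]
      fun y => ContinuousAlternatingMap.ofSubsingleton ℝ (ℝ × JetModelSpace n) ℝ (0 : Fin 1)
        (modelLiouvilleForm y) := by
    filter_upwards [extChartAt_target_mem_nhds u] with y hy
    ext v
    exact liouvilleForm_mfderiv_extChartAt_symm u hy (v 0)
  refine DifferentiableAt.congr_of_eventuallyEq ?_ h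
  have hd := (contDiff_modelLiouvilleForm (n := n)).differentiable (by simp)
  exact differentiableAt_ofSubsingleton (hd _)

/-- The one-form `-∑ y_i dx_i` on `ℝ^{2m}`. -/
def stdPrimitive (m : ℕ) : StdSpace m →L[ℝ] StdSpace m →L[ℝ] ℝ :=
  -∑ i : Fin m, (EuclideanSpace.proj (𝕜 := ℝ) (Sum.inr i : Fin m ⊕ Fin m)).smulRight
    (EuclideanSpace.proj (𝕜 := ℝ) (Sum.inl i : Fin m ⊕ Fin m))

lemma stdPrimitive_apply {m : ℕ} (q v : StdSpace m) :
    stdPrimitive m q v = -∑ i : Fin m, q (Sum.inr i) * v (Sum.inl i) := by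
  simp [stdPrimitive]

/-- Symmetry of second derivatives removes `df`; the linear remainder is its own derivative, and
antisymmetrizing it gives `ω₀`. -/
lemma extDeriv_fderiv_add_stdPrimitive {m : ℕ} {f : StdSpace m → ℝ} {p : StdSpace m}
    (hf : ContDiffAt ℝ ∞ f p) (v w : StdSpace m) :
    extDeriv (fun q => ContinuousAlternatingMap.ofSubsingleton ℝ (StdSpace m) ℝ (0 : Fin 1)
      (fderiv ℝ f q + stdPrimitive m q)) p ![v, w] = stdForm v w := by
  have hd : DifferentiableAt ℝ (fderiv ℝ f) p :=
    (hf.fderiv_right (m := 1) (by norm_cast)).differentiableAt (by simp)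
  have hd' : DifferentiableAt ℝ (fun q => fderiv ℝ f q + stdPrimitive m q) p :=
    hd.add (stdPrimitive m).differentiableAt
  have hsymm : fderiv ℝ (fderiv ℝ f) p v w = fderiv ℝ (fderiv ℝ f) p w v :=
    hf.isSymmSndFDerivAt minSmoothness_two_le_infty v w
  rw [extDeriv_ofSubsingleton_apply hd', fderiv_fun_add hd (stdPrimitive m).differentiableAt,
    (stdPrimitive m).fderiv]
  simp only [add_apply, stdPrimitive_apply, hsymm, stdForm]
  rw [add_sub_add_left_eq_sub, neg_sub_neg, ← Finset.sum_sub_distrib]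
  exact Finset.sum_congr rfl fun i _ => by ring

/-- A map into a chart of `ℝ × J^1 M` that pulls `e^s (dz - y dx)` back to a primitive of the
standard symplectic form is symplectic. -/
lemma symplForm_mfderiv_extChartAt_symm_comp (u₀ : Symplectization n M)
    {U : Set (StdSpace (n + 1))} (hU : IsOpen U) {g : StdSpace (n + 1) → ℝ × JetModelSpace n}
    (hg : ContDiffOn ℝ ∞ g U) (hgt : MapsTo g U (extChartAt (symplModel n) u₀).target)
    {f : StdSpace (n + 1) → ℝ} (hf : ContDiffOn ℝ ∞ f U)
    (hgf : ∀ q ∈ U, ∀ v, modelLiouvilleForm (g q) (fderiv ℝ g q v) =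
      fderiv ℝ f q v + stdPrimitive (n + 1) q v) {p : StdSpace (n + 1)} (hp : p ∈ U)
    (v w : StdSpace (n + 1)) :
    symplForm (((extChartAt (symplModel n) u₀).symm ∘ g) p)
      ![mfderiv 𝓘(ℝ, StdSpace (n + 1)) (symplModel n) ((extChartAt (symplModel n) u₀).symm ∘ g) p v,
        mfderiv 𝓘(ℝ, StdSpace (n + 1)) (symplModel n) ((extChartAt (symplModel n) u₀).symm ∘ g) p w]
      = stdForm v w := by
  have hψ : ContMDiffOn 𝓘(ℝ, StdSpace (n + 1)) (symplModel n) ∞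
      ((extChartAt (symplModel n) u₀).symm ∘ g) U :=
    (contMDiffOn_extChartAt_symm u₀).comp hg.contMDiffOn hgt
  have hga : ∀ q ∈ U, DifferentiableAt ℝ g q := fun q hq =>
    (hg.contDiffAt (hU.mem_nhds hq)).differentiableAt (by simp)
  refine (extDerivOneForm_mfderiv (symplModel n) liouvilleForm hU hψ hp
    (differentiableAt_oneFormInChart_liouvilleForm _)
    (θ := fun q => fderiv ℝ f q + stdPrimitive (n + 1) q) ?_ v w).trans
    (extDeriv_fderiv_add_stdPrimitive (hf.contDiffAt (hU.mem_nhds hp)) v w)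
  intro q hq e
  refine Eq.trans ?_ (hgf q hq e)
  rw [← liouvilleForm_mfderiv_extChartAt_symm u₀ (hgt hq), ← mfderiv_eq_fderiv]
  refine congrArg (liouvilleForm ((extChartAt (symplModel n) u₀).symm (g q))) ?_
  exact mfderiv_comp_apply q ((contMDiffAt_extChartAt_symm_of_mem_target _ _
    (hgt hq)).mdifferentiableAt (by simp)) (hga q hq).mdifferentiableAt e

end Symplectic

/-! ### An area-preserving map from a disc into a rectangle. -/

section Profile

/-- The area between `0` and `x` below the upper half of the circle of radius `R`, signed so that
its derivative is the height `√(R² - x²)` of the circle. -/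
def discPrimitive (R x : ℝ) : ℝ := (x * √(R ^ 2 - x ^ 2) + R ^ 2 * Real.arcsin (x / R)) / 2

variable {R x : ℝ}

lemma sq_sub_sq_pos_of_mem_Ioo (hx : x ∈ Ioo (-R) R) : 0 < R ^ 2 - x ^ 2 := by
  nlinarith [hx.1, hx.2]

lemma div_mem_Ioo_of_mem_Ioo (hx : x ∈ Ioo (-R) R) : x / R ∈ Ioo (-1 : ℝ) 1 := by
  have hR : 0 < R := by linarith [hx.1, hx.2]
  constructor
  · rw [lt_div_iff₀ hR]; linarith [hx.1]
  · rw [div_lt_iff₀ hR]; linarith [hx.2]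

lemma hasDerivAt_discPrimitive (hx : x ∈ Ioo (-R) R) :
    HasDerivAt (discPrimitive R) (√(R ^ 2 - x ^ 2)) x := by
  have hR : 0 < R := by linarith [hx.1, hx.2]
  have hp := sq_sub_sq_pos_of_mem_Ioo hx
  have hxR := div_mem_Ioo_of_mem_Ioo hx
  have hs : √(1 - (x / R) ^ 2) = √(R ^ 2 - x ^ 2) / R := by
    rw [show 1 - (x / R) ^ 2 = (R ^ 2 - x ^ 2) / R ^ 2 by field_simp,
      Real.sqrt_div hp.le, Real.sqrt_sq hR.le]
  have h1 : HasDerivAt (fun x : ℝ => √(R ^ 2 - x ^ 2)) ((-(2 * x)) / (2 * √(R ^ 2 - x ^ 2))) x := by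
    refine HasDerivAt.sqrt ?_ hp.ne'
    simpa using ((hasDerivAt_id x).pow 2).const_sub (R ^ 2)
  have h2 : HasDerivAt (fun x : ℝ => Real.arcsin (x / R)) (1 / √(1 - (x / R) ^ 2) * (1 / R)) x :=
    (Real.hasDerivAt_arcsin hxR.1.ne' hxR.2.ne).comp (h := fun x => x / R) x
      ((hasDerivAt_id x).div_const R)
  have h3 := (((hasDerivAt_id x).mul h1).add (h2.const_mul (R ^ 2))).div_const 2
  refine h3.congr_deriv ?_
  have hsq := Real.sq_sqrt hp.le
  have hs0 : √(R ^ 2 - x ^ 2) ≠ 0 := (Real.sqrt_pos.2 hp).ne'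
  rw [hs]
  simp only [id]
  field_simp
  linear_combination (-1 : ℝ) * hsq

lemma contDiffOn_sqrt_sq_sub_sq : ContDiffOn ℝ ∞ (fun x : ℝ => √(R ^ 2 - x ^ 2)) (Ioo (-R) R) :=
  ContDiffOn.sqrt (by fun_prop) fun _ hx => (sq_sub_sq_pos_of_mem_Ioo hx).ne'

lemma contDiffOn_discPrimitive : ContDiffOn ℝ ∞ (discPrimitive R) (Ioo (-R) R) := by
  unfold discPrimitive
  refine ((contDiffOn_id.mul contDiffOn_sqrt_sq_sub_sq).add
    (contDiffOn_const.mul fun x hx => ?_)).div_const 2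
  have hxR := div_mem_Ioo_of_mem_Ioo hx
  exact ((Real.contDiffAt_arcsin hxR.1.ne' hxR.2.ne).comp x
    (contDiffAt_id.div_const R)).contDiffWithinAt

/-- With `x = R sin a` the signed area is `R² (sin 2a + 2a) / 4`, and `sin t ≤ t` at `t = π - 2a`
and `t = π + 2a` bounds it by that of a quarter disc. -/
lemma abs_discPrimitive_le (hx : x ∈ Ioo (-R) R) : |discPrimitive R x| ≤ Real.pi * R ^ 2 / 4 := by
  have hR : 0 < R := by linarith [hx.1, hx.2]
  have hp := sq_sub_sq_pos_of_mem_Ioo hx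
  have hxR := div_mem_Ioo_of_mem_Ioo hx
  set a := Real.arcsin (x / R) with ha
  have hsin : Real.sin a = x / R := Real.sin_arcsin hxR.1.le hxR.2.le
  have hcos : Real.cos a = √(R ^ 2 - x ^ 2) / R := by
    rw [ha, Real.cos_arcsin, show 1 - (x / R) ^ 2 = (R ^ 2 - x ^ 2) / R ^ 2 by field_simp,
      Real.sqrt_div hp.le, Real.sqrt_sq hR.le]
  have heq : discPrimitive R x = R ^ 2 * (Real.sin (2 * a) + 2 * a) / 4 := by
    rw [Real.sin_two_mul, hsin, hcos, discPrimitive, ← ha]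
    field_simp
    ring
  have h1 : Real.sin (2 * a) ≤ Real.pi - 2 * a := by
    rw [← Real.sin_pi_sub]
    exact Real.sin_le (by linarith [Real.arcsin_le_pi_div_two (x / R)])
  have h2 : -Real.sin (2 * a) ≤ 2 * a + Real.pi := by
    rw [← Real.sin_add_pi]
    exact Real.sin_le (by linarith [Real.neg_pi_div_two_le_arcsin (x / R)])
  have hR2 : 0 < R ^ 2 := by positivity
  rw [heq, abs_le]
  constructor
  · nlinarith
  · nlinarith

/-- The data of an area-preserving embedding `(x, y) ↦ (u x, y / v x)` of the disc of radius `r`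
into the rectangle `(0, 1) × [-k, k]`, defined over `(-R, R)`. -/
structure IsDiscProfile (r R k : ℝ) (u v : ℝ → ℝ) : Prop where
  hasDerivAt : ∀ x ∈ Ioo (-R) R, HasDerivAt u (v x) x
  deriv_pos : ∀ x ∈ Ioo (-R) R, 0 < v x
  mem_Ioo : ∀ x ∈ Ioo (-R) R, u x ∈ Ioo (0 : ℝ) 1
  contDiffOn : ContDiffOn ℝ ∞ u (Ioo (-R) R)
  contDiffOn_deriv : ContDiffOn ℝ ∞ v (Ioo (-R) R)
  abs_div_le : ∀ x y, x ^ 2 + y ^ 2 ≤ r ^ 2 → |y / v x| ≤ k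

lemma IsDiscProfile.injOn {r R k : ℝ} {u v : ℝ → ℝ} (h : IsDiscProfile r R k u v) :
    InjOn u (Ioo (-R) R) := by
  refine (strictMonoOn_of_deriv_pos (convex_Ioo _ _) h.contDiffOn.continuousOn ?_).injOn
  intro x hx
  rw [interior_Ioo] at hx
  rw [(h.hasDerivAt x hx).deriv]
  exact h.deriv_pos x hx

/-- Each vertical slice of the disc of radius `R` is stretched to length `2h`, and its horizontal
coordinate is replaced by the swept area divided by `2h`, up to centring at `1/2`. Passing to the
smaller radius `r` keeps the image in heights at most `h r / R`, strictly less than `h`; this margin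
pays for the later compactness argument. -/
lemma isDiscProfile {r R h : ℝ} (hr : 0 < r) (hrR : r < R) (hh : Real.pi * R ^ 2 < 2 * h) :
    IsDiscProfile r R (h * r / R) (fun x => 1 / 2 + discPrimitive R x / h)
      (fun x => √(R ^ 2 - x ^ 2) / h) := by
  have hR : 0 < R := hr.trans hrR
  have h0 : 0 < h := by have := Real.pi_pos; nlinarith [mul_pos this (pow_pos hR 2)]
  refine ⟨fun x hx => ((hasDerivAt_discPrimitive hx).div_const h).const_add _, fun x hx => ?_,
    fun x hx => ?_, contDiffOn_const.add (contDiffOn_discPrimitive.div_const h),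
    contDiffOn_sqrt_sq_sub_sq.div_const h, fun x y hxy => ?_⟩
  · exact div_pos (Real.sqrt_pos.2 (sq_sub_sq_pos_of_mem_Ioo hx)) h0
  · have h1 : |discPrimitive R x / h| < 1 / 2 := by
      rw [abs_div, abs_of_pos h0, div_lt_iff₀ h0]
      linarith [abs_discPrimitive_le hx]
    constructor <;> linarith [(abs_lt.1 h1).1, (abs_lt.1 h1).2]
  · have hp : 0 < R ^ 2 - x ^ 2 := by nlinarith [sq_nonneg y]
    have hs := Real.sqrt_pos.2 hp
    rw [div_div_eq_mul_div, abs_div, abs_of_pos hs, abs_mul, abs_of_pos h0,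
      div_le_div_iff₀ hs hR]
    -- After squaring: `R² y² ≤ R² (r² - x²) ≤ r² (R² - x²)`, as `r < R`.
    have h1 : |y| * R ≤ r * √(R ^ 2 - x ^ 2) := by
      refine le_of_sq_le_sq ?_ (by positivity)
      rw [mul_pow, mul_pow, Real.sq_sqrt hp.le, sq_abs]
      nlinarith [sq_nonneg x, sq_nonneg y, mul_nonneg (sq_nonneg x) (by nlinarith : 0 ≤ R ^ 2 - r ^ 2)]
    nlinarith

end Profile

/-- The inverse function theorem, with a smooth inverse on the whole target. -/
lemma exists_openPartialHomeomorph_contDiffOn_symm {E : Type*} [NormedAddCommGroup E]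
    [NormedSpace ℝ E] [CompleteSpace E] {O : Set E} (hO : IsOpen O) {G : E → E}
    (hG : ContDiffOn ℝ ∞ G O) {y₀ : E} (hy₀ : y₀ ∈ O) {A : E ≃L[ℝ] E}
    (hA : fderiv ℝ G y₀ = (A : E →L[ℝ] E)) :
    ∃ e : OpenPartialHomeomorph E E, y₀ ∈ e.source ∧ e.source ⊆ O ∧ (∀ x, e x = G x) ∧
      ContDiffOn ℝ ∞ e.symm e.target := by
  have hat : ∀ y ∈ O, ContDiffAt ℝ ∞ G y := fun y hy => hG.contDiffAt (hO.mem_nhds hy)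
  have hd : ∀ y ∈ O, HasFDerivAt G (fderiv ℝ G y) y := fun y hy =>
    ((hat y hy).differentiableAt (by simp)).hasFDerivAt
  have hd₀ : HasFDerivAt G (A : E →L[ℝ] E) y₀ := hA ▸ hd y₀ hy₀
  have hcont : ContinuousOn (fderiv ℝ G) O := hG.continuousOn_fderiv_of_isOpen hO (by simp)
  -- Invertible operators form an open set; shrinking to the points with invertible derivative makes
  -- the local inverse smooth at every point of its target, not only at the image of `y₀`.
  set S := O ∩ fderiv ℝ G ⁻¹' range ((↑) : (E ≃L[ℝ] E) → E →L[ℝ] E) with hS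
  have hSo : IsOpen S := hcont.isOpen_inter_preimage hO ContinuousLinearEquiv.isOpen
  set e₀ := (hat y₀ hy₀).toOpenPartialHomeomorph G hd₀ (by simp) with he₀
  have hcoe : ∀ x, (e₀.restrOpen S hSo) x = G x := fun _ => rfl
  have hsub : (e₀.restrOpen S hSo).source ⊆ S := by
    rw [OpenPartialHomeomorph.restrOpen_source]
    exact inter_subset_right
  refine ⟨e₀.restrOpen S hSo, ?_, hsub.trans inter_subset_left, hcoe, ?_⟩
  · rw [OpenPartialHomeomorph.restrOpen_source]
    exact ⟨ContDiffAt.mem_toOpenPartialHomeomorph_source _ _ _, hy₀, A, hA.symm⟩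
  · intro x hx
    have hx' := hsub ((e₀.restrOpen S hSo).map_target hx)
    obtain ⟨B, hB⟩ := hx'.2
    have hfun : ((e₀.restrOpen S hSo) : E → E) = G := funext hcoe
    refine ((e₀.restrOpen S hSo).contDiffAt_symm (f₀' := B) hx ?_ ?_).contDiffWithinAt
    · rw [hfun, hB]
      exact hd _ hx'.1
    · rw [hfun]
      exact hat _ hx'.1

/-! ### A Legendrian near a regular point of its front is a one-jet graph. -/

section Sheet

variable {n : ℕ} {M : Type*} [TopologicalSpace M] [ChartedSpace (EuclideanSpace ℝ (Fin n)) M]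
  [IsManifold (𝓡 n) ∞ M]

lemma jet_extChartAt_fst_fst_mem_target {p₀ p : JetSpace n M}
    (hp : p ∈ (extChartAt (jetModel n) p₀).source) :
    (extChartAt (jetModel n) p₀ p).1.1 ∈ (extChartAt (𝓡 n) p₀.1.proj).target := by
  have := (extChartAt (jetModel n) p₀).map_source hp
  rw [jet_extChartAt_target] at this
  exact this.1.1

lemma front_eq_of_mem_extChartAt_source {p₀ p : JetSpace n M}
    (hp : p ∈ (extChartAt (jetModel n) p₀).source) :
    front p = ((extChartAt (𝓡 n) p₀.1.proj).symm (extChartAt (jetModel n) p₀ p).1.1,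
      (extChartAt (jetModel n) p₀ p).2) := by
  rw [← front_extChartAt_symm p₀ ((extChartAt (jetModel n) p₀).map_source hp),
    (extChartAt (jetModel n) p₀).left_inv hp]

lemma jet_extChartAt_fst_fst {p₀ p : JetSpace n M}
    (hp : p ∈ (extChartAt (jetModel n) p₀).source) :
    (extChartAt (jetModel n) p₀ p).1.1 = extChartAt (𝓡 n) p₀.1.proj p.1.proj :=
  ((congrArg (fun x : M × ℝ => extChartAt (𝓡 n) p₀.1.proj x.1)
    (front_eq_of_mem_extChartAt_source hp)).trans
    ((extChartAt (𝓡 n) p₀.1.proj).right_inv (jet_extChartAt_fst_fst_mem_target hp))).symm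

lemma contMDiff_front :
    ContMDiff (jetModel n) ((𝓡 n).prod 𝓘(ℝ, ℝ)) ∞ (front : JetSpace n M → M × ℝ) :=
  ((contMDiff_proj _).comp contMDiff_fst).prodMk contMDiff_snd

variable {N : Type*} [TopologicalSpace N] [ChartedSpace (EuclideanSpace ℝ (Fin n)) N]

/-- A map to `J^1 M`, read in the charts at `a₀` and at `ι a₀`. -/
def jetInCharts (ι : N → JetSpace n M) (a₀ : N) (y : EuclideanSpace ℝ (Fin n)) : JetModelSpace n :=
  extChartAt (jetModel n) (ι a₀) (ι ((extChartAt (𝓡 n) a₀).symm y))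

/-- The set on which `jetInCharts ι a₀` reads `ι`. -/
def jetInChartsDomain (ι : N → JetSpace n M) (a₀ : N) : Set (EuclideanSpace ℝ (Fin n)) :=
  (extChartAt (𝓡 n) a₀).target ∩
    (fun y => ι ((extChartAt (𝓡 n) a₀).symm y)) ⁻¹' (extChartAt (jetModel n) (ι a₀)).source

variable {ι : N → JetSpace n M} {a₀ : N}

lemma self_mem_jetInChartsDomain : extChartAt (𝓡 n) a₀ a₀ ∈ jetInChartsDomain ι a₀ := by
  refine ⟨mem_extChartAt_target a₀, ?_⟩
  rw [mem_preimage, extChartAt_to_inv]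
  exact mem_extChartAt_source _

lemma extChartAt_symm_jetInCharts {y : EuclideanSpace ℝ (Fin n)}
    (hy : y ∈ jetInChartsDomain ι a₀) :
    (extChartAt (jetModel n) (ι a₀)).symm (jetInCharts ι a₀ y) =
      ι ((extChartAt (𝓡 n) a₀).symm y) :=
  (extChartAt (jetModel n) (ι a₀)).left_inv hy.2

lemma jetInCharts_mem_target {y : EuclideanSpace ℝ (Fin n)} (hy : y ∈ jetInChartsDomain ι a₀) :
    jetInCharts ι a₀ y ∈ (extChartAt (jetModel n) (ι a₀)).target :=
  (extChartAt (jetModel n) (ι a₀)).map_source hy.2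

lemma IsLegendrianEmbedding.contMDiff (hι : IsLegendrianEmbedding ι) :
    ContMDiff (𝓡 n) (jetModel n) ∞ ι :=
  hι.isSmoothEmbedding.contMDiff

variable [IsManifold (𝓡 n) ∞ N]

lemma contMDiffOn_comp_extChartAt_symm (hι : ContMDiff (𝓡 n) (jetModel n) ∞ ι) :
    ContMDiffOn 𝓘(ℝ, EuclideanSpace ℝ (Fin n)) (jetModel n) ∞
      (fun y => ι ((extChartAt (𝓡 n) a₀).symm y)) (extChartAt (𝓡 n) a₀).target :=
  hι.comp_contMDiffOn (contMDiffOn_extChartAt_symm a₀)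

lemma isOpen_jetInChartsDomain (hι : ContMDiff (𝓡 n) (jetModel n) ∞ ι) :
    IsOpen (jetInChartsDomain ι a₀) :=
  (contMDiffOn_comp_extChartAt_symm hι).continuousOn.isOpen_inter_preimage
    (isOpen_extChartAt_target a₀) (isOpen_extChartAt_source _)

lemma contDiffOn_jetInCharts (hι : ContMDiff (𝓡 n) (jetModel n) ∞ ι) :
    ContDiffOn ℝ ∞ (jetInCharts ι a₀) (jetInChartsDomain ι a₀) := by
  rw [← contMDiffOn_iff_contDiffOn]
  refine (contMDiffOn_extChartAt (x := ι a₀)).comp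
    ((contMDiffOn_comp_extChartAt_symm hι).mono inter_subset_left) fun y hy => ?_
  have := hy.2
  rwa [mem_preimage, extChartAt_source] at this

/-- The Legendrian condition in charts. -/
lemma IsLegendrianEmbedding.modelContactForm_fderiv (hι : IsLegendrianEmbedding ι)
    {y : EuclideanSpace ℝ (Fin n)} (hy : y ∈ jetInChartsDomain ι a₀)
    (v : EuclideanSpace ℝ (Fin n)) :
    modelContactForm (jetInCharts ι a₀ y) (fderiv ℝ (jetInCharts ι a₀) y v) = 0 := by
  have hO := (isOpen_jetInChartsDomain (a₀ := a₀) hι.contMDiff).mem_nhds hy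
  rw [← contactForm_mfderiv_extChartAt_symm (ι a₀) (jetInCharts_mem_target hy),
    ← mfderiv_eq_fderiv]
  have h1 : mfderiv 𝓘(ℝ, JetModelSpace n) (jetModel n) (extChartAt (jetModel n) (ι a₀)).symm
      (jetInCharts ι a₀ y) (mfderiv 𝓘(ℝ, EuclideanSpace ℝ (Fin n)) 𝓘(ℝ, JetModelSpace n)
        (jetInCharts ι a₀) y v) =
      mfderiv (𝓡 n) (jetModel n) ι ((extChartAt (𝓡 n) a₀).symm y)
        (mfderiv 𝓘(ℝ, EuclideanSpace ℝ (Fin n)) (𝓡 n) (extChartAt (𝓡 n) a₀).symm y v) := by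
    have h2 := mfderiv_apply_mfderiv_of_eventuallyEq (I := 𝓘(ℝ, JetModelSpace n))
      (I' := jetModel n) (f := (extChartAt (jetModel n) (ι a₀)).symm) (g := jetInCharts ι a₀)
      (k := fun y => ι ((extChartAt (𝓡 n) a₀).symm y)) (y := y)
      (by filter_upwards [hO] with w hw using extChartAt_symm_jetInCharts hw)
      ((contMDiffAt_extChartAt_symm_of_mem_target _ _
        (jetInCharts_mem_target hy)).mdifferentiableAt (by simp))
      (((contDiffOn_jetInCharts hι.contMDiff).contDiffAt hO).differentiableAt
        (by simp)).mdifferentiableAt v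
    have h3 := mfderiv_apply_mfderiv_of_eventuallyEq (I := 𝓡 n) (I' := jetModel n) (f := ι)
      (g := (extChartAt (𝓡 n) a₀).symm) (y := y) (EventuallyEq.refl _ _)
      (hι.contMDiff.mdifferentiableAt (by simp))
      ((contMDiffAt_extChartAt_symm_of_mem_target _ _ hy.1).mdifferentiableAt (by simp)) v
    exact h2.trans h3.symm
  refine Eq.trans ?_ (hι.tangent ((extChartAt (𝓡 n) a₀).symm y) (mfderiv
    𝓘(ℝ, EuclideanSpace ℝ (Fin n)) (𝓡 n) (extChartAt (𝓡 n) a₀).symm y v))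
  refine (congrArg _ h1).trans ?_
  rw [extChartAt_symm_jetInCharts hy]

/-- At a nonsingular point of the front, the projection of the Legendrian to `M` is an immersion. -/
lemma IsLegendrianEmbedding.injective_fderiv_base (hι : IsLegendrianEmbedding ι)
    (hns : ¬ IsFrontSingular ι a₀) :
    Function.Injective
      (fderiv ℝ (fun y => (jetInCharts ι a₀ y).1.1) (extChartAt (𝓡 n) a₀ a₀)) := by
  have hmem := self_mem_jetInChartsDomain (ι := ι) (a₀ := a₀)
  have hO := (isOpen_jetInChartsDomain (a₀ := a₀) hι.contMDiff).mem_nhds hmem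
  set y₀ := extChartAt (𝓡 n) a₀ a₀
  have hK : HasFDerivAt (jetInCharts ι a₀) (fderiv ℝ (jetInCharts ι a₀) y₀) y₀ :=
    (((contDiffOn_jetInCharts hι.contMDiff).contDiffAt hO).differentiableAt (by simp)).hasFDerivAt
  have hx : HasFDerivAt (fun y => (jetInCharts ι a₀ y).1.1)
      ((jetModelBase n).comp (fderiv ℝ (jetInCharts ι a₀) y₀)) y₀ :=
    (jetModelBase n).hasFDerivAt.comp y₀ hK
  have hxz : HasFDerivAt (fun y => ((jetInCharts ι a₀ y).1.1, (jetInCharts ι a₀ y).2))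
      (((jetModelBase n).comp (fderiv ℝ (jetInCharts ι a₀) y₀)).prod
        ((ContinuousLinearMap.snd ℝ _ _).comp (fderiv ℝ (jetInCharts ι a₀) y₀))) y₀ :=
    hx.prodMk (hasFDerivAt_snd.comp y₀ hK)
  have hinj : Function.Injective (((jetModelBase n).comp (fderiv ℝ (jetInCharts ι a₀) y₀)).prod
        ((ContinuousLinearMap.snd ℝ _ _).comp (fderiv ℝ (jetInCharts ι a₀) y₀))) := by
    have h := not_not.1 hns
    have hw : writtenInExtChartAt (𝓡 n) ((𝓡 n).prod 𝓘(ℝ, ℝ)) a₀ (fun x => front (ι x)) =ᶠ[𝓝 y₀]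
        fun y => ((jetInCharts ι a₀ y).1.1, (jetInCharts ι a₀ y).2) := by
      filter_upwards [hO] with y hy
      simp only [writtenInExtChartAt, Function.comp_apply]
      rw [front_eq_of_mem_extChartAt_source hy.2, extChartAt_prod]
      exact Prod.ext ((extChartAt (𝓡 n) (ι a₀).1.proj).right_inv
        (jet_extChartAt_fst_fst_mem_target hy.2)) rfl
    have hfd : MDifferentiableAt (𝓡 n) ((𝓡 n).prod 𝓘(ℝ, ℝ)) (fun x => front (ι x)) a₀ :=
      (contMDiff_front.comp hι.contMDiff).mdifferentiableAt (by simp)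
    rw [hfd.mfderiv] at h
    have hr : range (𝓡 n) = univ := ModelWithCorners.range_eq_univ _
    rw [hr, fderivWithin_univ, hw.fderiv_eq, hxz.fderiv] at h
    exact h
  rw [hx.fderiv]
  refine (injective_iff_map_eq_zero _).2 fun v hv => ?_
  -- On a Legendrian `dz = y dx`, so a vector killed by the base projection is also killed by `dz`,
  -- hence by the whole front differential.
  refine (injective_iff_map_eq_zero _).1 hinj v (Prod.ext hv ?_)
  have hv' : (fderiv ℝ (jetInCharts ι a₀) y₀ v).1.1 = 0 := hv
  have hl := hι.modelContactForm_fderiv hmem v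
  rw [modelContactForm_apply, hv', map_zero, sub_zero] at hl
  exact hl

/-- Near a nonsingular point of its front, a Legendrian is the one-jet of a function. -/
lemma IsLegendrianEmbedding.exists_local_primitive (hι : IsLegendrianEmbedding ι)
    (hns : ¬ IsFrontSingular ι a₀) :
    ∃ (D : Set (EuclideanSpace ℝ (Fin n))) (f : EuclideanSpace ℝ (Fin n) → ℝ)
      (η : EuclideanSpace ℝ (Fin n) → EuclideanSpace ℝ (Fin n) →L[ℝ] ℝ) (V : Set N),
      IsOpen D ∧ extChartAt (𝓡 n) (ι a₀).1.proj (ι a₀).1.proj ∈ D ∧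
      D ⊆ (extChartAt (𝓡 n) (ι a₀).1.proj).target ∧ ContDiffOn ℝ ∞ f D ∧ ContDiffOn ℝ ∞ η D ∧
      (∀ x ∈ D, HasFDerivAt f (η x) x) ∧
      f (extChartAt (𝓡 n) (ι a₀).1.proj (ι a₀).1.proj) = (ι a₀).2 ∧ IsOpen V ∧ a₀ ∈ V ∧
      (∀ x ∈ D, (extChartAt (jetModel n) (ι a₀)).symm ((x, η x), f x) ∈ range ι) ∧
      ∀ a ∈ V, ∃ x ∈ D, ι a = (extChartAt (jetModel n) (ι a₀)).symm ((x, η x), f x) := by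
  have hmem := self_mem_jetInChartsDomain (ι := ι) (a₀ := a₀)
  have hOpen := isOpen_jetInChartsDomain (a₀ := a₀) hι.contMDiff
  have hinj := hι.injective_fderiv_base hns
  set y₀ := extChartAt (𝓡 n) a₀ a₀ with hy₀
  have hK := contDiffOn_jetInCharts (a₀ := a₀) hι.contMDiff
  have hG : ContDiffOn ℝ ∞ (fun y => (jetInCharts ι a₀ y).1.1) (jetInChartsDomain ι a₀) :=
    (jetModelBase n).contDiff.comp_contDiffOn hK
  -- The Legendrian and the base both have dimension `n`, so the injective derivative of the base
  -- projection is an isomorphism.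
  obtain ⟨e, hes, heO, heG, hesymm⟩ := exists_openPartialHomeomorph_contDiffOn_symm hOpen hG hmem
    (A := (LinearEquiv.ofInjectiveEndo _ hinj).toContinuousLinearEquiv) (by ext v; rfl)
  have hmaps : MapsTo e.symm e.target (jetInChartsDomain ι a₀) := fun x hx =>
    heO (e.map_target hx)
  have hbase : ∀ x ∈ e.target, (jetInCharts ι a₀ (e.symm x)).1.1 = x := fun x hx => by
    rw [← heG, e.right_inv hx]
  have hKs : ContDiffOn ℝ ∞ (fun x => jetInCharts ι a₀ (e.symm x)) e.target :=
    hK.comp hesymm hmaps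
  have hpt : ∀ x ∈ e.target, ((x, (jetInCharts ι a₀ (e.symm x)).1.2),
      (jetInCharts ι a₀ (e.symm x)).2) = jetInCharts ι a₀ (e.symm x) := fun x hx =>
    Prod.ext (Prod.ext (hbase x hx).symm rfl) rfl
  have hself : jetInCharts ι a₀ y₀ = extChartAt (jetModel n) (ι a₀) (ι a₀) := by
    rw [jetInCharts, hy₀, extChartAt_to_inv]
  have hx₀ : e y₀ = extChartAt (𝓡 n) (ι a₀).1.proj (ι a₀).1.proj := by
    rw [heG, hself, jet_extChartAt_fst_fst (mem_extChartAt_source _)]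
  refine ⟨e.target, fun x => (jetInCharts ι a₀ (e.symm x)).2,
    fun x => (jetInCharts ι a₀ (e.symm x)).1.2,
    (extChartAt (𝓡 n) a₀).source ∩ extChartAt (𝓡 n) a₀ ⁻¹' e.source, e.open_target,
    hx₀ ▸ e.map_source hes, ?_, contDiff_snd.comp_contDiffOn hKs,
    contDiff_snd.comp_contDiffOn (contDiff_fst.comp_contDiffOn hKs), ?_, ?_, ?_, ?_, ?_, ?_⟩
  · intro x hx
    rw [← hbase x hx]
    exact jet_extChartAt_fst_fst_mem_target (hmaps hx).2
  · intro x hx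
    have hxn := e.open_target.mem_nhds hx
    have hy := hmaps hx
    have hL := (((hKs.contDiffAt hxn).differentiableAt (by simp)).hasFDerivAt)
    set L := fderiv ℝ (fun x => jetInCharts ι a₀ (e.symm x)) x
    have hcomp : L = (fderiv ℝ (jetInCharts ι a₀) (e.symm x)).comp (fderiv ℝ e.symm x) :=
      fderiv_comp x ((hK.contDiffAt (hOpen.mem_nhds hy)).differentiableAt (by simp))
        ((hesymm.contDiffAt hxn).differentiableAt (by simp))
    -- Parametrized by the base point, the sheet has identity base component, so the relation `dz =
    -- y dx` reads `df = η`.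
    have hid : (jetModelBase n).comp L = ContinuousLinearMap.id ℝ _ := by
      have h1 : HasFDerivAt (fun x => (jetInCharts ι a₀ (e.symm x)).1.1)
          ((jetModelBase n).comp L) x := (jetModelBase n).hasFDerivAt.comp x hL
      refine h1.unique ((hasFDerivAt_id x).congr_of_eventuallyEq ?_)
      filter_upwards [hxn] with x' hx' using hbase x' hx'
    refine (hasFDerivAt_snd.comp x hL).congr_fderiv (ContinuousLinearMap.ext fun v => ?_)
    have hl := hι.modelContactForm_fderiv hy (fderiv ℝ e.symm x v)
    have hLv : fderiv ℝ (jetInCharts ι a₀) (e.symm x) (fderiv ℝ e.symm x v) = L v := by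
      rw [hcomp]
      rfl
    have hv : (L v).1.1 = v := DFunLike.congr_fun hid v
    rw [hLv, modelContactForm_apply, hv, sub_eq_zero] at hl
    exact hl
  · simp only [← hx₀, e.left_inv hes, hself]
    rfl
  · exact (continuousOn_extChartAt a₀).isOpen_inter_preimage (isOpen_extChartAt_source a₀)
      e.open_source
  · exact ⟨mem_extChartAt_source a₀, hes⟩
  · intro x hx
    rw [hpt x hx, extChartAt_symm_jetInCharts (hmaps hx)]
    exact mem_range_self _
  · rintro a ⟨has, hae⟩
    refine ⟨e (extChartAt (𝓡 n) a₀ a), e.map_source hae, ?_⟩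
    rw [hpt _ (e.map_source hae), e.left_inv hae, extChartAt_symm_jetInCharts (heO hae),
      (extChartAt (𝓡 n) a₀).left_inv has]

end Sheet

/-! ### The squeezing map and its Liouville form. -/

section Embedding

variable {n : ℕ}

/-- The coordinates `(x_1, …, x_n)` of a point of `ℝ^{2n+2}` with coordinates
`(x_0, …, x_n, y_0, …, y_n)`. -/
def stdTailX (n : ℕ) : StdSpace (n + 1) →L[ℝ] EuclideanSpace ℝ (Fin n) :=
  (EuclideanSpace.equiv (Fin n) ℝ).symm.toContinuousLinearMap.comp
    (ContinuousLinearMap.pi fun i => EuclideanSpace.proj (𝕜 := ℝ) (Sum.inl i.succ))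

/-- The covector `∑_{i ≥ 1} y_i dx_i` at a point of `ℝ^{2n+2}` with coordinates
`(x_0, …, x_n, y_0, …, y_n)`. -/
def stdTailY (n : ℕ) : StdSpace (n + 1) →L[ℝ] EuclideanSpace ℝ (Fin n) →L[ℝ] ℝ :=
  ∑ i : Fin n, (EuclideanSpace.proj (𝕜 := ℝ) (Sum.inr i.succ : Fin (n + 1) ⊕ Fin (n + 1))).smulRight
    (EuclideanSpace.proj (𝕜 := ℝ) i)

/-- The coordinate `x_0`. -/
abbrev stdHeadX (n : ℕ) : StdSpace (n + 1) →L[ℝ] ℝ := EuclideanSpace.proj (𝕜 := ℝ) (Sum.inl 0)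

/-- The coordinate `y_0`. -/
abbrev stdHeadY (n : ℕ) : StdSpace (n + 1) →L[ℝ] ℝ := EuclideanSpace.proj (𝕜 := ℝ) (Sum.inr 0)

@[simp] lemma stdTailX_apply (q : StdSpace (n + 1)) (i : Fin n) :
    stdTailX n q i = q (Sum.inl i.succ) := rfl

lemma stdTailY_apply (q : StdSpace (n + 1)) (v : EuclideanSpace ℝ (Fin n)) :
    stdTailY n q v = ∑ i, q (Sum.inr i.succ) * v i := by
  simp [stdTailY]

lemma stdPrimitive_eq (q v : StdSpace (n + 1)) :
    stdPrimitive (n + 1) q v = -(stdHeadY n q * stdHeadX n v) - stdTailY n q (stdTailX n v) := by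
  rw [stdPrimitive_apply, Fin.sum_univ_succ, stdTailY_apply]
  simp
  ring

lemma stdTailY_apply_single (q : StdSpace (n + 1)) (i : Fin n) :
    stdTailY n q (EuclideanSpace.single i 1) = q (Sum.inr i.succ) := by
  simp [stdTailY_apply]

lemma stdSpace_eq_of {q q' : StdSpace (n + 1)} (h1 : stdHeadX n q = stdHeadX n q')
    (h2 : stdHeadY n q = stdHeadY n q') (h3 : stdTailX n q = stdTailX n q')
    (h4 : stdTailY n q = stdTailY n q') : q = q' := by
  ext i
  rcases i with i | i
  · refine Fin.cases h1 (fun i => ?_) i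
    exact congrArg (fun x : EuclideanSpace ℝ (Fin n) => x i) h3
  · refine Fin.cases h2 (fun i => ?_) i
    rw [← stdTailY_apply_single, ← stdTailY_apply_single, h4]

lemma sq_stdHead_le (q : StdSpace (n + 1)) : stdHeadX n q ^ 2 + stdHeadY n q ^ 2 ≤ ‖q‖ ^ 2 := by
  rw [EuclideanSpace.norm_sq_eq, Fintype.sum_sum_type, Fin.sum_univ_succ, Fin.sum_univ_succ]
  simp only [Real.norm_eq_abs, sq_abs]
  have h1 : 0 ≤ ∑ i : Fin n, q (Sum.inl i.succ) ^ 2 := Finset.sum_nonneg fun i _ => sq_nonneg _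
  have h2 : 0 ≤ ∑ i : Fin n, q (Sum.inr i.succ) ^ 2 := Finset.sum_nonneg fun i _ => sq_nonneg _
  have h3 : stdHeadX n q = q (Sum.inl 0) := rfl
  have h4 : stdHeadY n q = q (Sum.inr 0) := rfl
  rw [h3, h4]
  linarith

lemma norm_stdTailX_le (q : StdSpace (n + 1)) : ‖stdTailX n q‖ ≤ ‖q‖ := by
  refine le_of_sq_le_sq ?_ (norm_nonneg _)
  rw [EuclideanSpace.norm_sq_eq, EuclideanSpace.norm_sq_eq, Fintype.sum_sum_type,
    Fin.sum_univ_succ]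
  simp only [stdTailX_apply]
  have h2 : 0 ≤ ∑ i : Fin (n + 1), ‖q (Sum.inr i)‖ ^ 2 := Finset.sum_nonneg fun i _ => sq_nonneg _
  have := sq_nonneg ‖q (Sum.inl 0)‖
  linarith

lemma stdHeadX_mem_Ioo {R : ℝ} {q : StdSpace (n + 1)} (hq : q ∈ Metric.ball 0 R) :
    stdHeadX n q ∈ Ioo (-R) R := by
  rw [mem_ball_zero_iff] at hq
  rw [mem_Ioo, ← abs_lt]
  refine lt_of_le_of_lt (abs_le_of_sq_le_sq ?_ (norm_nonneg q)) hq
  nlinarith [sq_stdHead_le q, sq_nonneg (stdHeadY n q)]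

/-- The map from `ℝ^{2n+2}` to the model of `ℝ × J^1 M` which stretches the `(x_0, y_0)`-plane by
`(x, y) ↦ (u x, y / v x)`, squeezes the other `x`-directions by the factor `δ`, and is sheared along
the one-jet of `f`. -/
def squeezeMap (u v : ℝ → ℝ) (x₀ : EuclideanSpace ℝ (Fin n)) (δ : ℝ)
    (f : EuclideanSpace ℝ (Fin n) → ℝ) (η : EuclideanSpace ℝ (Fin n) → EuclideanSpace ℝ (Fin n) →L[ℝ] ℝ)
    (q : StdSpace (n + 1)) : ℝ × JetModelSpace n :=
  (Real.log (u (stdHeadX n q)),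
    (x₀ + δ • stdTailX n q,
      η (x₀ + δ • stdTailX n q) + (δ * u (stdHeadX n q))⁻¹ • stdTailY n q),
    f (x₀ + δ • stdTailX n q) + stdHeadY n q / v (stdHeadX n q))

variable {r R k : ℝ} {u v : ℝ → ℝ} {x₀ : EuclideanSpace ℝ (Fin n)} {δ : ℝ}
  {f : EuclideanSpace ℝ (Fin n) → ℝ} {η : EuclideanSpace ℝ (Fin n) → EuclideanSpace ℝ (Fin n) →L[ℝ] ℝ}
  {D : Set (EuclideanSpace ℝ (Fin n))}

lemma contDiffOn_squeezeMap (huv : IsDiscProfile r R k u v) (hδ : 0 < δ)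
    (hD : ∀ q ∈ Metric.ball (0 : StdSpace (n + 1)) R, x₀ + δ • stdTailX n q ∈ D)
    (hf : ContDiffOn ℝ ∞ f D) (hη : ContDiffOn ℝ ∞ η D) :
    ContDiffOn ℝ ∞ (squeezeMap u v x₀ δ f η) (Metric.ball 0 R) := by
  have hX : ContDiffOn ℝ ∞ (stdHeadX n) (Metric.ball 0 R) := (stdHeadX n).contDiff.contDiffOn
  have hu : ContDiffOn ℝ ∞ (fun q => u (stdHeadX n q)) (Metric.ball 0 R) :=
    huv.contDiffOn.comp hX fun q hq => stdHeadX_mem_Ioo hq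
  have hv : ContDiffOn ℝ ∞ (fun q => v (stdHeadX n q)) (Metric.ball 0 R) :=
    huv.contDiffOn_deriv.comp hX fun q hq => stdHeadX_mem_Ioo hq
  have hu0 : ∀ q ∈ Metric.ball (0 : StdSpace (n + 1)) R, u (stdHeadX n q) ≠ 0 := fun q hq =>
    (huv.mem_Ioo _ (stdHeadX_mem_Ioo hq)).1.ne'
  have hv0 : ∀ q ∈ Metric.ball (0 : StdSpace (n + 1)) R, v (stdHeadX n q) ≠ 0 := fun q hq =>
    (huv.deriv_pos _ (stdHeadX_mem_Ioo hq)).ne'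
  have hx : ContDiffOn ℝ ∞ (fun q => x₀ + δ • stdTailX n q) (Metric.ball 0 R) :=
    (contDiff_const.add (δ • stdTailX n).contDiff).contDiffOn
  have hinv : ContDiffOn ℝ ∞ (fun q => (δ * u (stdHeadX n q))⁻¹) (Metric.ball 0 R) :=
    (contDiffOn_const.mul hu).inv fun q hq => mul_ne_zero hδ.ne' (hu0 q hq)
  exact (hu.log hu0).prodMk ((hx.prodMk ((hη.comp hx hD).add
    (hinv.smul (stdTailY n).contDiff.contDiffOn))).prodMk
    ((hf.comp hx hD).add ((stdHeadY n).contDiff.contDiffOn.div hv hv0)))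

/-- Write `X`, `Y` for the tail coordinates and `m = y_0 / v`. As `df = η`, the shear cancels and
the form becomes `u dm - Y dX`, the factors `δ` and `u` cancelling their inverses. Then `u dm = d(u
m) - m du`, and `m du = y_0 dx_0` because `u' = v`. -/
lemma modelLiouvilleForm_squeezeMap (huv : IsDiscProfile r R k u v) (hδ : 0 < δ)
    (hD : ∀ q ∈ Metric.ball (0 : StdSpace (n + 1)) R, x₀ + δ • stdTailX n q ∈ D)
    (hf : ContDiffOn ℝ ∞ f D) (hη : ContDiffOn ℝ ∞ η D) (hfη : ∀ x ∈ D, HasFDerivAt f (η x) x)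
    {q : StdSpace (n + 1)} (hq : q ∈ Metric.ball 0 R) (w : StdSpace (n + 1)) :
    modelLiouvilleForm (squeezeMap u v x₀ δ f η q) (fderiv ℝ (squeezeMap u v x₀ δ f η) q w) =
      fderiv ℝ (fun q => u (stdHeadX n q) * (stdHeadY n q / v (stdHeadX n q))) q w +
        stdPrimitive (n + 1) q w := by
  have hqX := stdHeadX_mem_Ioo hq
  have hu0 := (huv.mem_Ioo _ hqX).1
  have hv0 := (huv.deriv_pos _ hqX).ne'
  have hg := ((contDiffOn_squeezeMap huv hδ hD hf hη).contDiffAt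
    (Metric.isOpen_ball.mem_nhds hq)).differentiableAt (by simp) |>.hasFDerivAt
  set g' := fderiv ℝ (squeezeMap u v x₀ δ f η) q
  have hx : HasFDerivAt (fun q => x₀ + δ • stdTailX n q) (δ • stdTailX n) q :=
    ((stdTailX n).hasFDerivAt.const_smul δ).const_add x₀
  have hm : DifferentiableAt ℝ (fun q => stdHeadY n q / v (stdHeadX n q)) q := by
    refine ((stdHeadY n).contDiff.contDiffAt.div ?_ hv0).differentiableAt (n := ∞) (by simp)
    exact (huv.contDiffOn_deriv.contDiffAt (isOpen_Ioo.mem_nhds hqX)).comp q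
      (stdHeadX n).contDiff.contDiffAt
  have hm' := hm.hasFDerivAt
  set m' := fderiv ℝ (fun q => stdHeadY n q / v (stdHeadX n q)) q
  have hu : HasFDerivAt (fun q => u (stdHeadX n q)) (v (stdHeadX n q) • stdHeadX n) q :=
    (huv.hasDerivAt _ hqX).comp_hasFDerivAt q (stdHeadX n).hasFDerivAt
  have h1 : (g' w).2.1.1 = δ • stdTailX n w := by
    have : HasFDerivAt (fun q => x₀ + δ • stdTailX n q)
        ((jetModelBase n).comp ((ContinuousLinearMap.snd ℝ _ _).comp g')) q :=
      ((jetModelBase n).comp (ContinuousLinearMap.snd ℝ ℝ (JetModelSpace n))).hasFDerivAt.comp q hg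
    exact DFunLike.congr_fun (this.unique hx) w
  have h2 : (g' w).2.2 = η (x₀ + δ • stdTailX n q) (δ • stdTailX n w) + m' w := by
    have h3 : HasFDerivAt
        (fun q => f (x₀ + δ • stdTailX n q) + stdHeadY n q / v (stdHeadX n q))
        ((ContinuousLinearMap.snd ℝ _ _).comp ((ContinuousLinearMap.snd ℝ _ _).comp g')) q :=
      ((ContinuousLinearMap.snd ℝ _ _).comp
        (ContinuousLinearMap.snd ℝ ℝ (JetModelSpace n))).hasFDerivAt.comp q hg
    have h4 := ((hfη _ (hD q hq)).comp q hx).add hm'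
    exact DFunLike.congr_fun (h3.unique h4) w
  rw [modelLiouvilleForm_apply, h1, h2, (hu.fun_mul hm').fderiv, stdPrimitive_eq]
  simp only [squeezeMap, Real.exp_log hu0, add_apply, smul_apply, smul_eq_mul, map_smul]
  field_simp
  ring

end Embedding

/-! ### The squeezing map as a relative symplectic embedding. -/

section RelativeEmbedding

variable {n : ℕ} {M : Type*} [TopologicalSpace M] [ChartedSpace (EuclideanSpace ℝ (Fin n)) M]
  [IsManifold (𝓡 n) ∞ M]
variable {r R k : ℝ} {u v : ℝ → ℝ} {x₀ : EuclideanSpace ℝ (Fin n)} {δ : ℝ}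
  {f : EuclideanSpace ℝ (Fin n) → ℝ}
  {η : EuclideanSpace ℝ (Fin n) → EuclideanSpace ℝ (Fin n) →L[ℝ] ℝ}
  {D : Set (EuclideanSpace ℝ (Fin n))} {p₀ : JetSpace n M} {Λ : Set (JetSpace n M)}

lemma sympl_extChartAt_symm_apply (u₀ : Symplectization n M) (y : ℝ × JetModelSpace n) :
    (extChartAt (symplModel n) u₀).symm y = (y.1, (extChartAt (jetModel n) u₀.2).symm y.2) := by
  rw [extChartAt_prod]
  rfl

/-- The squeezing map along a graphical piece of `Λ` is a relative embedding of the ball, provided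
that there are no further points of `Λ` at height at most `k` above or below this piece. -/
lemma isRelSymplEmbedding_squeezeMap (huv : IsDiscProfile r R k u v) (hrR : r < R) (hδ : 0 < δ)
    (hD : ∀ q ∈ Metric.ball (0 : StdSpace (n + 1)) R, x₀ + δ • stdTailX n q ∈ D)
    (hDt : D ⊆ (extChartAt (𝓡 n) p₀.1.proj).target)
    (hf : ContDiffOn ℝ ∞ f D) (hη : ContDiffOn ℝ ∞ η D) (hfη : ∀ x ∈ D, HasFDerivAt f (η x) x)
    (hΛ : ∀ x ∈ D, (extChartAt (jetModel n) p₀).symm ((x, η x), f x) ∈ Λ)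
    (hΛ' : ∀ x ∈ D, ∀ p ∈ Λ, p.1.proj = (extChartAt (𝓡 n) p₀.1.proj).symm x → |p.2 - f x| ≤ k →
      p = (extChartAt (jetModel n) p₀).symm ((x, η x), f x)) :
    IsRelSymplEmbedding (univ ×ˢ Λ) ⊥ 0 r
      ((extChartAt (symplModel n) ((0 : ℝ), p₀)).symm ∘ squeezeMap u v x₀ δ f η) := by
  have hsub : Metric.closedBall (0 : StdSpace (n + 1)) r ⊆ Metric.ball 0 R :=
    Metric.closedBall_subset_ball hrR
  have hsm := contDiffOn_squeezeMap huv hδ hD hf hη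
  have htgt : MapsTo (squeezeMap u v x₀ δ f η) (Metric.ball (0 : StdSpace (n + 1)) R)
      (extChartAt (symplModel n) ((0 : ℝ), p₀)).target := by
    intro q hq
    rw [sympl_extChartAt_target]
    exact ⟨mem_univ _, ⟨hDt (hD q hq), mem_univ _⟩, mem_univ _⟩
  have htgt' : ∀ q ∈ Metric.ball (0 : StdSpace (n + 1)) R,
      (squeezeMap u v x₀ δ f η q).2 ∈ (extChartAt (jetModel n) p₀).target := by
    intro q hq
    rw [jet_extChartAt_target]
    exact ⟨⟨hDt (hD q hq), mem_univ _⟩, mem_univ _⟩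
  have hX := fun q hq => stdHeadX_mem_Ioo (n := n) (R := R) (q := q) hq
  have hneg : ∀ q ∈ Metric.ball (0 : StdSpace (n + 1)) R, Real.log (u (stdHeadX n q)) < 0 :=
    fun q hq => Real.log_neg (huv.mem_Ioo _ (hX q hq)).1 (huv.mem_Ioo _ (hX q hq)).2
  have hslab : ∀ q ∈ Metric.ball (0 : StdSpace (n + 1)) R,
      (⊥ : EReal) < (Real.log (u (stdHeadX n q)) : ℝ) ∧
        ((Real.log (u (stdHeadX n q)) : ℝ) : EReal) < 0 :=
    fun q hq => ⟨EReal.bot_lt_coe _, by exact_mod_cast hneg q hq⟩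
  refine ⟨⟨Metric.ball 0 R, Metric.isOpen_ball, hsub,
    (contMDiffOn_extChartAt_symm _).comp hsm.contMDiffOn htgt⟩, ?_, ?_, ?_, ?_⟩
  · intro q hq q' hq' hqq'
    replace hq := hsub hq
    replace hq' := hsub hq'
    have heq : squeezeMap u v x₀ δ f η q = squeezeMap u v x₀ δ f η q' :=
      (extChartAt (symplModel n) ((0 : ℝ), p₀)).symm.injOn (htgt hq) (htgt hq') hqq'
    have h1 : stdHeadX n q = stdHeadX n q' :=
      huv.injOn (hX q hq) (hX q' hq') (Real.log_injOn_pos (huv.mem_Ioo _ (hX q hq)).1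
        (huv.mem_Ioo _ (hX q' hq')).1 (congrArg Prod.fst heq))
    have h2 : stdTailX n q = stdTailX n q' := by
      have : x₀ + δ • stdTailX n q = x₀ + δ • stdTailX n q' :=
        congrArg (fun y : ℝ × JetModelSpace n => y.2.1.1) heq
      exact smul_right_injective _ hδ.ne' (add_left_cancel this)
    have h3 := congrArg (fun y : ℝ × JetModelSpace n => y.2.1.2) heq
    have h4 := congrArg (fun y : ℝ × JetModelSpace n => y.2.2) heq
    simp only [squeezeMap, h1, h2, add_right_inj] at h3 h4
    refine stdSpace_eq_of h1 ?_ h2 (smul_right_injective _ (inv_ne_zero (mul_ne_zero hδ.ne'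
      (huv.mem_Ioo _ (hX q' hq')).1.ne')) h3)
    exact (div_left_inj' (huv.deriv_pos _ (hX q' hq')).ne').1 h4
  · intro q hq
    rw [Function.comp_apply, sympl_extChartAt_symm_apply]
    exact ⟨mem_univ _, hslab q (hsub hq)⟩
  · intro q hq
    refine symplForm_mfderiv_extChartAt_symm_comp _ Metric.isOpen_ball hsm htgt ?_
      (fun q hq => modelLiouvilleForm_squeezeMap huv hδ hD hf hη hfη hq) (hsub hq)
    have hXc : ContDiffOn ℝ ∞ (stdHeadX n) (Metric.ball 0 R) := (stdHeadX n).contDiff.contDiffOn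
    exact (huv.contDiffOn.comp hXc hX).mul ((stdHeadY n).contDiff.contDiffOn.div
      (huv.contDiffOn_deriv.comp hXc hX) fun q hq => (huv.deriv_pos _ (hX q hq)).ne')
  · intro q hq
    have hqR := hsub hq
    have hv0 := (huv.deriv_pos _ (hX q hqR)).ne'
    rw [Function.comp_apply, sympl_extChartAt_symm_apply]
    have hfront := front_extChartAt_symm p₀ (htgt' q hqR)
    constructor
    -- An image point on `Λ` has height within `k` of the sheet, so `hΛ'` identifies it with the
    -- point of the sheet over the same base point. Comparing covectors and heights forces all `y_i`
    -- to vanish.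
    · rintro ⟨⟨-, hmem⟩, -⟩
      have hqr : stdHeadX n q ^ 2 + stdHeadY n q ^ 2 ≤ r ^ 2 :=
        (sq_stdHead_le q).trans (pow_le_pow_left₀ (norm_nonneg _) (mem_closedBall_zero_iff.1 hq) 2)
      have hz : ((extChartAt (jetModel n) p₀).symm (squeezeMap u v x₀ δ f η q).2).2 =
          f (x₀ + δ • stdTailX n q) + stdHeadY n q / v (stdHeadX n q) := congrArg Prod.snd hfront
      have heq := hΛ' _ (hD q hqR) _ hmem (congrArg Prod.fst hfront) (by
        rw [hz, add_sub_cancel_left]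
        exact huv.abs_div_le _ _ hqr)
      have heq' := (extChartAt (jetModel n) p₀).symm.injOn (htgt' q hqR) (by
        rw [PartialEquiv.symm_source, jet_extChartAt_target]
        exact ⟨⟨hDt (hD q hqR), mem_univ _⟩, mem_univ _⟩) heq
      have hY := congrArg (fun y : JetModelSpace n => y.1.2) heq'
      have hy := congrArg (fun y : JetModelSpace n => y.2) heq'
      simp only [squeezeMap, add_eq_left, smul_eq_zero, div_eq_zero_iff, hv0, or_false,
        inv_eq_zero, mul_eq_zero, hδ.ne', (huv.mem_Ioo _ (hX q hqR)).1.ne', false_or] at hY hy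
      refine Fin.cases hy fun i => ?_
      rw [← stdTailY_apply_single, hY]
      rfl
    · intro h0
      have hY : stdTailY n q = 0 := by
        ext w
        simp [stdTailY_apply, h0]
      have hy : stdHeadY n q = 0 := h0 0
      refine ⟨⟨mem_univ _, ?_⟩, hslab q hqR⟩
      have : (squeezeMap u v x₀ δ f η q).2 = ((x₀ + δ • stdTailX n q, η (x₀ + δ • stdTailX n q)),
          f (x₀ + δ • stdTailX n q)) := by
        simp [squeezeMap, hY, hy]
      rw [this]
      exact hΛ _ (hD q hqR)

end RelativeEmbedding

/-! ### Isolating one sheet by compactness, and the width estimate. -/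

section Width

variable {n : ℕ} {M : Type*} [TopologicalSpace M] [ChartedSpace (EuclideanSpace ℝ (Fin n)) M]
  {N : Type*} [TopologicalSpace N]

/-- If all points of `N` whose front lies on a vertical segment belong to `V`, then so do all those
whose front lies on a slightly shorter vertical segment nearby. -/
lemma eventually_forall_mem_of_front_segment [T2Space M] [CompactSpace N] {ι : N → JetSpace n M}
    (hι : Continuous fun a => front (ι a)) {V : Set N} (hV : IsOpen V)
    {χ : EuclideanSpace ℝ (Fin n) → M} {f : EuclideanSpace ℝ (Fin n) → ℝ}
    {x₀ : EuclideanSpace ℝ (Fin n)} (hχ : ContinuousAt χ x₀) (hf : ContinuousAt f x₀) {k k' : ℝ}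
    (hkk' : k < k') (hseg : ∀ a, (ι a).1.proj = χ x₀ → |(ι a).2 - f x₀| ≤ k' → a ∈ V) :
    ∀ᶠ x in 𝓝 x₀, ∀ a, (ι a).1.proj = χ x → |(ι a).2 - f x| ≤ k → a ∈ V := by
  -- The front of the rest of the Legendrian is compact and misses the closed segment of half-length
  -- `k'`, so it misses a product neighbourhood of it. The gap `k' - k` absorbs the variation of
  -- `f`.
  have hcl : IsClosed ((fun a => front (ι a)) '' Vᶜ) := (hV.isClosed_compl.isCompact.image hι).isClosed
  obtain ⟨A, B, hA, hB, hxA, hIB, hAB⟩ := generalized_tube_lemma (isCompact_singleton (x := χ x₀))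
    (isCompact_Icc (a := f x₀ - k') (b := f x₀ + k')) hcl.isOpen_compl (by
      rintro ⟨x, z⟩ ⟨hx, hz⟩ ⟨a, ha, hax⟩
      have hx' : (ι a).1.proj = x := congrArg Prod.fst hax
      have hz' : (ι a).2 = z := congrArg Prod.snd hax
      refine ha (hseg a (hx'.trans hx) ?_)
      rw [hz', abs_le]
      constructor <;> linarith [hz.1, hz.2])
  filter_upwards [hχ (hA.mem_nhds (hxA rfl)), hf (Metric.ball_mem_nhds _ (sub_pos.2 hkk'))]
    with x hxA' hxf a ha haz
  by_contra haV
  rw [mem_preimage, Metric.mem_ball, Real.dist_eq, abs_lt] at hxf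
  rw [abs_le] at haz
  refine hAB (⟨?_, hIB ⟨?_, ?_⟩⟩ : front (ι a) ∈ A ×ˢ B) ⟨a, haV, rfl⟩
  · show (ι a).1.proj ∈ A
    rw [ha]
    exact hxA'
  · show f x₀ - k' ≤ (ι a).2
    linarith [haz.1, hxf.1]
  · show (ι a).2 ≤ f x₀ + k'
    linarith [haz.2, hxf.2]

variable [IsManifold (𝓡 n) ∞ M] [CompactSpace N] [ChartedSpace (EuclideanSpace ℝ (Fin n)) N] [IsManifold (𝓡 n) ∞ N]
  [T2Space M] {ι : N → JetSpace n M} {a₀ : N} {h : ℝ}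

/-- The relative embedding of a ball of any capacity less than `2h` around a point of the cylinder
over a Legendrian, given that its front has no other points at distance less than `h` on the vertical
line through this point. -/
lemma IsLegendrianEmbedding.exists_isRelSymplEmbedding (hι : IsLegendrianEmbedding ι)
    (hns : ¬ IsFrontSingular ι a₀)
    (hiso : ∀ a, (ι a).1.proj = (ι a₀).1.proj → |(ι a).2 - (ι a₀).2| < h → a = a₀)
    {r : ℝ} (hr : 0 < r) (hrh : Real.pi * r ^ 2 < 2 * h) :
    ∃ ψ, IsRelSymplEmbedding (univ ×ˢ range ι) ⊥ 0 r ψ := by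
  -- A slightly larger radius provides an open domain for the map and the strict inequality `h * r /
  -- R < h`.
  obtain ⟨R, hrR, hRh⟩ : ∃ R, r < R ∧ Real.pi * R ^ 2 < 2 * h := by
    have hc : ContinuousAt (fun R : ℝ => Real.pi * R ^ 2) r := by fun_prop
    have h1 : ∀ᶠ R in 𝓝[>] r, Real.pi * R ^ 2 < 2 * h :=
      nhdsWithin_le_nhds (hc.eventually_lt_const hrh)
    obtain ⟨R, hR, hR'⟩ := (h1.and self_mem_nhdsWithin).exists
    exact ⟨R, hR', hR⟩
  have hR : 0 < R := hr.trans hrR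
  have h0 : 0 < h := by have := Real.pi_pos; nlinarith [mul_pos this (pow_pos hR 2)]
  have huv := isDiscProfile hr hrR hRh
  have hk : h * r / R < h := by rw [div_lt_iff₀ hR]; nlinarith
  obtain ⟨k', hkk', hk'⟩ := exists_between hk
  obtain ⟨D, f, η, V, hDo, hxD, hDt, hf, hη, hfη, hfx, hV, haV, hmem, hgraph⟩ :=
    hι.exists_local_primitive hns
  set χ := extChartAt (𝓡 n) (ι a₀).1.proj with hχ
  set x₀ := χ (ι a₀).1.proj with hx₀
  have hχx : χ.symm x₀ = (ι a₀).1.proj := extChartAt_to_inv _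
  have hev := eventually_forall_mem_of_front_segment (ι := ι) (χ := χ.symm) (f := f) (x₀ := x₀)
    (contMDiff_front.continuous.comp hι.contMDiff.continuous) hV
    (continuousAt_extChartAt_symm _) (hfη x₀ hxD).continuousAt hkk' (by
      intro a ha haz
      rw [hχx] at ha
      rw [hfx] at haz
      rwa [hiso a ha (haz.trans_lt hk')])
  obtain ⟨ρ, hρ, hball⟩ := Metric.eventually_nhds_iff_ball.1 (hev.and (hDo.mem_nhds hxD))
  -- With `δ = ρ / R`, the ball of radius `R` projects into the base ball of radius `ρ`, where only
  -- one sheet is met.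
  have hδ : 0 < ρ / R := div_pos hρ hR
  have hsub : Metric.ball x₀ ρ ⊆ D := fun x hx => (hball x hx).2
  refine ⟨_, isRelSymplEmbedding_squeezeMap (x₀ := x₀) (D := Metric.ball x₀ ρ) huv hrR hδ ?_
    (hsub.trans hDt) (hf.mono hsub) (hη.mono hsub) (fun x hx => hfη x (hsub hx))
    (fun x hx => hmem x (hsub hx)) ?_⟩
  · intro q hq
    rw [mem_ball_iff_norm, add_sub_cancel_left, norm_smul, Real.norm_of_nonneg hδ.le]
    rw [mem_ball_zero_iff] at hq
    calc ρ / R * ‖stdTailX n q‖ ≤ ρ / R * ‖q‖ := by gcongr; exact norm_stdTailX_le q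
      _ < ρ / R * R := by gcongr
      _ = ρ := by field_simp
  · rintro x hx _ ⟨a, rfl⟩ hax haz
    -- The point lies in `V`, hence on the graph over some `x'`; injectivity of the inverse chart
    -- gives `x' = x`.
    obtain ⟨x', hx', hax'⟩ := hgraph a ((hball x hx).1 a hax haz)
    have hproj : (ι a).1.proj = χ.symm x' := by
      rw [hax']
      refine congrArg Prod.fst (front_extChartAt_symm (ι a₀) (y := ((x', η x'), f x')) ?_)
      rw [jet_extChartAt_target]
      exact ⟨⟨hDt hx', mem_univ _⟩, mem_univ _⟩
    have : x' = x := χ.symm.injOn (hDt hx') (hDt (hsub hx)) (hproj.symm.trans hax)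
    rw [hax', this]

/-- Every capacity `d < 2h` is realized, by the radius `√(d/π)`; the value `2h` itself is reached
only as a supremum, so the bound is tested against all smaller `c`. -/
lemma IsLegendrianEmbedding.le_relGromovWidth (hι : IsLegendrianEmbedding ι)
    (hns : ¬ IsFrontSingular ι a₀)
    (hiso : ∀ a, (ι a).1.proj = (ι a₀).1.proj → |(ι a).2 - (ι a₀).2| < h → a = a₀) :
    ENNReal.ofReal (2 * h) ≤ relGromovWidth (univ ×ˢ range ι) ⊥ 0 := by
  refine le_of_forall_lt fun c hc => ?_
  obtain ⟨d, hcd, hd⟩ := ENNReal.lt_iff_exists_nnreal_btwn.1 hc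
  have hd' : (d : ℝ) < 2 * h := by
    rw [← ENNReal.ofReal_coe_nnreal] at hd
    exact (ENNReal.ofReal_lt_ofReal_iff_of_nonneg d.2).1 hd
  have hd0 : (0 : ℝ) < d := by
    exact_mod_cast pos_of_gt hcd
  have hpi := Real.pi_pos
  have hsq : Real.pi * √(d / Real.pi) ^ 2 = d := by
    rw [Real.sq_sqrt (by positivity)]
    field_simp
  refine hcd.trans_le (le_sSup ⟨√(d / Real.pi), Real.sqrt_pos.2 (by positivity),
    hι.exists_isRelSymplEmbedding hns hiso (Real.sqrt_pos.2 (by positivity)) ?_, ?_⟩)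
  · rwa [hsq]
  · rw [hsq, ENNReal.ofReal_coe_nnreal]

end Width

/-! ### Height along a Reeb chord. -/

section ReebChord

variable {n : ℕ} {M : Type*} [TopologicalSpace M] [ChartedSpace (EuclideanSpace ℝ (Fin n)) M]
  [IsManifold (𝓡 n) ∞ M]

/-- The endpoints of a Reeb chord differ in height by the height of the chord. -/
lemma IsReebChord.snd_end {Λ : Set (JetSpace n M)} {γ : ℝ → JetSpace n M} {h : ℝ}
    (hγ : IsReebChord Λ γ h) : (γ h).2 = (γ 0).2 + h := by
  have hd : ∀ t ∈ Icc 0 h, HasDerivWithinAt (fun t => (γ t).2) 1 (Icc 0 h) t := by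
    intro t ht
    have h1 := hγ.isIntegralCurve t ht
    have h2 : HasMFDerivAt (jetModel n) 𝓘(ℝ, ℝ) (Prod.snd : JetSpace n M → ℝ) (γ t)
        (mfderiv (jetModel n) 𝓘(ℝ, ℝ) Prod.snd (γ t)) := mdifferentiableAt_snd.hasMFDerivAt
    have h3 : mfderiv (jetModel n) 𝓘(ℝ, ℝ) (Prod.snd : JetSpace n M → ℝ) (γ t)
        ((1 : ℝ) • reebField (γ t)) = (1 : ℝ) := by
      rw [one_smul, mfderiv_snd]
      rfl
    obtain ⟨L, hL, hL1⟩ : ∃ L : ℝ →L[ℝ] ℝ,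
        HasFDerivWithinAt (fun t => (γ t).2) L (Icc 0 h) t ∧ L 1 = 1 :=
      ⟨_, (h2.comp_hasMFDerivWithinAt t h1).hasFDerivWithinAt, h3⟩
    exact hL1 ▸ hL.hasDerivWithinAt
  -- The height grows at unit speed, so its difference with `t` is constant on the chord.
  have hd' : ∀ t ∈ Icc 0 h, HasDerivWithinAt (fun t => (γ t).2 - t) 0 (Icc 0 h) t := fun t ht =>
    ((hd t ht).fun_sub (hasDerivWithinAt_id t _)).congr_deriv (sub_self 1)
  have hconst := constant_of_derivWithin_zero (fun t ht => (hd' t ht).differentiableWithinAt)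
    (fun t ht => (hd' t (Ico_subset_Icc_self ht)).derivWithin
      (uniqueDiffOn_Icc hγ.height_pos t (Ico_subset_Icc_self ht)))
    h (right_mem_Icc.2 hγ.height_pos.le)
  linarith

end ReebChord

end

theorem theorem1p2 {n : ℕ} {M : Type*} [TopologicalSpace M] [T2Space M]
    [ChartedSpace (EuclideanSpace ℝ (Fin n)) M] [IsManifold (𝓡 n) ∞ M]
    {N : Type*} [TopologicalSpace N] [CompactSpace N]
    [ChartedSpace (EuclideanSpace ℝ (Fin n)) N] [IsManifold (𝓡 n) ∞ N]
    (ι : N → JetSpace n M) (hι : IsLegendrianEmbedding ι)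
    (γ : ℝ → JetSpace n M) (h : ℝ) (hγ : IsReebChord (range ι) γ h)
    (hext : IsFrontwiseDoublyExtendable ι γ h) :
    ENNReal.ofReal (2 * h) ≤ relGromovWidth (univ ×ˢ range ι) ⊥ 0 := by
  have hinj : Function.Injective ι := hι.isSmoothEmbedding.isEmbedding.injective
  have h0 := hγ.height_pos
  have hz := hγ.snd_end
  obtain ⟨hns, hext⟩ := hext
  obtain ⟨a, ha⟩ := hγ.start_mem
  obtain ⟨b, hb⟩ := hγ.end_mem
  rcases hext with hext | hext
  -- With room below the chord, the ball is centred over its lower endpoint. The upper endpoint lies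
  -- at distance exactly `h`, so the strict inequality in the isolation condition excludes it.
  · refine hι.le_relGromovWidth (a₀ := a) (fun hs => (hns a hs).1 (by rw [ha])) ?_
    intro c hc hcz
    rw [ha] at hc hcz
    rw [abs_lt] at hcz
    have hlow : (γ 0).2 - h ≤ (ι c).2 := by linarith [hcz.1]
    have hupp : (ι c).2 ≤ (γ h).2 := by linarith [hcz.2]
    have hmem : ι c ∈ range ι ∩ {γ 0, γ h} := by
      rw [← hext]
      exact ⟨⟨hc, hlow, hupp⟩, mem_range_self c⟩
    rcases hmem.2 with hc' | hc'
    · exact hinj (hc'.trans ha.symm)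
    · rw [hc', hz] at hcz
      linarith [hcz.2]
  -- With room above, the upper endpoint serves instead. That it lies over the same base point is
  -- read off from the extendability identity, whose right side contains `γ h`.
  · have hproj : (γ h).1.proj = (γ 0).1.proj := by
      have : γ h ∈ range ι ∩ {γ 0, γ h} := ⟨hγ.end_mem, Or.inr rfl⟩
      rw [← hext] at this
      exact this.1.1
    refine hι.le_relGromovWidth (a₀ := b) (fun hs => (hns b hs).2 (by rw [hb])) ?_
    intro c hc hcz
    rw [hb] at hc hcz
    rw [abs_lt] at hcz
    have hlow : (γ 0).2 ≤ (ι c).2 := by linarith [hcz.1]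
    have hupp : (ι c).2 ≤ (γ h).2 + h := by linarith [hcz.2]
    have hmem : ι c ∈ range ι ∩ {γ 0, γ h} := by
      rw [← hext]
      exact ⟨⟨hc.trans hproj, hlow, hupp⟩, mem_range_self c⟩
    rcases hmem.2 with hc' | hc'
    · rw [hc', hz] at hcz
      linarith [hcz.1]
    · exact hinj (hc'.trans hb.symm)
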